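/- **Setting.** For each $n\in\mathbb N$ consider an experiment with $K=K(n)\ge 2$ populations, sample sizes $T_1,\dots,T_K$, dimension $d\ge 1$ and integer bandwidths $0<B<B_1<\mathcal T_\circ$, where $\mathcal T_\circ=\min_k T_k$ and $\mathcal T_\dagger=\max_k T_k$ (all of these, and all objects below, may depend on $n$). Let $\mathcal T_\circ\to\infty$ as $n\to\infty$. The observations are $\mathbf x_{t,k}=\boldsymbol\mu_k+\boldsymbol\epsilon_{t,k}\in\mathbb R^d$, and the test statistic is $\widehat R=\sum_{k=2}^K\widehat R_k$ with $$\widehat R_k=\frac{1}{V_k\sqrt d}\sum_{\substack{1\le t_1,t_2\le T_k\\ B\le|t_1-t_2|\le B_1}}\mathbf x_{t_1,k}^\top\mathbf x_{t_2,k}+\frac{1}{V_1\sqrt d}\sum_{\substack{1\le t_1,t_2\le T_1\\ B\le|t_1-t_2|\le B_1}}\mathbf x_{t_1,1}^\top\mathbf x_{t_2,1}-\frac{2}{T_kT_1\sqrt d}\sum_{t_1=1}^{T_k}\sum_{t_2=1}^{T_1}\mathbf x_{t_1,k}^\top\mathbf x_{t_2,1},$$ where $V_k$ is the number of pairs $(t_1,t_2)\in\{1,\dots,T_k\}^2$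 with $B\le|t_1-t_2|\le B_1$. Write $a_n\asymp b_n$ if $c|a_n|\le |b_n|\le C|a_n|$ for all large $n$, with constants $0<c\le C<\infty$. **Assumptions.** Let $M>8$ and $\alpha>14$. 1. The random elements $e_{t,k}$ ($t\in\mathbb Z$, $1\le k\le K$) are mutually independent, and $\boldsymbol\epsilon_{t,k}=g_{t,k}(e_{t,k},e_{t-1,k},\dots)$ with measurable $g_{t,k}$. Moreover each $(\boldsymbol\epsilon_{t,k})_{t\in\mathbb Z}$ is $(M,\alpha)$-short-range dependent: $\mathbf E\,\boldsymbol\epsilon_{t,k}=0$, and for a constant $C$ independent of $n$ and $k$, $$\sup_{t\in\mathbb Z,\ |\mathbf a|_2=1}\|\mathbf a^\top\boldsymbol\epsilon_{t,k}\|_M\le C,\qquad \sup_{s\ge 0}(1+s)^\alpha\sum_{j\ge s}\delta_{j,k}\le C,$$ where $\|X\|_M=(\mathbf E|X|^M)^{1/M}$, $\delta_{j,k}=\sup_{t\in\mathbb Z,\,|\mathbf a|_2=1}\|\mathbf a^\top(\boldsymbol\epsilon_{t,k}-\boldsymbol\epsilon_{t,k}(j))\|_M$, and $\boldsymbol\epsilon_{t,k}(j)$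 is $\boldsymbol\epsilon_{t,k}$ with the single innovation $e_{t-j,k}$ replaced by a copy with the same law, independent of all $e_{t',k}$. 2. $K=O(1)$, $\mathcal T_\circ\asymp\mathcal T_\dagger$, $d\asymp\mathcal T_\circ$, and $\max_k|\boldsymbol\mu_k|_\infty=O(1)$. 3. $B\asymp\mathcal T_\circ^{\kappa_1}$ and $B_1\asymp\mathcal T_\circ^{\kappa_2}$ with $\frac2\alpha<\kappa_1<\frac16$ and $\max\big(\kappa_1,\frac{4}{2\alpha-3}\big)<\kappa_2<\frac16$. 4. There is $c>0$ such that, for all large $n$, $\sum_{k=2}^K\mathrm{Var}(Q_k)+(K-1)^2\,\mathrm{Var}(Q_1)>c$, where $$Q_k=\frac{\sqrt{\mathcal T_\circ(B_1-B)}}{V_k\sqrt d}\sum_{\substack{1\le t_1,t_2\le T_k\\ B\le|t_1-t_2|\le B_1}}\big(\boldsymbol\epsilon_{t_1,k}^\top\boldsymbol\epsilon_{t_2,k}-\mathbf E[\boldsymbol\epsilon_{t_1,k}^\top\boldsymbol\epsilon_{t_2,k}]\big).$$ **Corollary B.1.** Under Assumptions 1–4, suppose that $\Delta:=\sum_{k=2}^K|\boldsymbol\mu_k-\boldsymbol\mu_1|_2^2\to\infty$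 as $n\to\infty$. Then: * there is a constant $C$ such that for every fixed $\gamma>0$ and all sufficiently large $n$ (depending on $\gamma$), $$\frac{\gamma}{\sqrt{\mathcal T_\circ(B_1-B)}}<\frac{\Delta}{\sqrt d}\quad\text{and}\quad \mathbf{Pr}\Big(\sqrt{\mathcal T_\circ(B_1-B)}\,\widehat R\le\gamma\Big)\le\frac{C}{\Big(\sqrt{\mathcal T_\circ}\,\Big(\frac{\Delta}{\sqrt d}-\frac{\gamma}{\sqrt{\mathcal T_\circ(B_1-B)}}\Big)\Big)^{M/2}};$$ * for every fixed $\gamma>0$, $\mathbf{Pr}\big(\sqrt{\mathcal T_\circ(B_1-B)}\,\widehat R\le\gamma\big)\to0$; * consequently, the power $\mathbf{Pr}\big(\sqrt{\mathcal T_\circ(B_1-B)}\,\widehat R>\gamma\big)$ of the test with threshold $\gamma$ tends to $1$. -/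

import Mathlib

open MeasureTheory ProbabilityTheory Filter Topology Asymptotics
open scoped ENNReal NNReal RealInnerProductSpace

noncomputable section

namespace TimeSeriesAnova

section ErrorModel

variable {Ω E : Type*} {d : ℕ}

/-- The causal vector process `ε_t = g_t (e_t, e_{t-1}, e_{t-2}, …)`: the `j`-th argument of `g_t`
is the innovation with time index `t - j`. -/
def errorSeries (e : ℤ → Ω → E) (g : ℤ → (ℕ → E) → EuclideanSpace ℝ (Fin d)) (t : ℤ) (ω : Ω) :
    EuclideanSpace ℝ (Fin d) :=
  g t (fun j => e (t - j) ω)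

/-- The coupled process `ε_t(s)`, in which the single innovation `e_{t-s}` is replaced by an
independent copy. It lives on `Ω × Ω` with the product measure: the original innovations are
read off the first coordinate and the independent copy of the innovations off the second one. -/
def coupledErrorSeries (e : ℤ → Ω → E) (g : ℤ → (ℕ → E) → EuclideanSpace ℝ (Fin d))
    (t : ℤ) (s : ℕ) (ω : Ω × Ω) : EuclideanSpace ℝ (Fin d) :=
  g t (fun j => if j = s then e (t - j) ω.2 else e (t - j) ω.1)

variable [MeasurableSpace Ω] [MeasurableSpace E]

/-- The physical dependence measure
`δ_s = sup { ‖aᵀ (ε_t - ε_t(s))‖_M : t ∈ ℤ, |a|₂ = 1 }`, with values in `[0, ∞]`. -/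
def dependenceMeasure (P : Measure Ω) (e : ℤ → Ω → E)
    (g : ℤ → (ℕ → E) → EuclideanSpace ℝ (Fin d)) (M : ℝ) (s : ℕ) : ℝ≥0∞ :=
  ⨆ (t : ℤ) (a : EuclideanSpace ℝ (Fin d)) (_ : ‖a‖ = 1),
    eLpNorm (fun ω : Ω × Ω => ⟪a, errorSeries e g t ω.1 - coupledErrorSeries e g t s ω⟫)
      (ENNReal.ofReal M) (P.prod P)

/-- `(M, α)`-short-range dependence, with `C` an explicit bound for the two quantities that are
required to be `O(1)`. -/
structure IsShortRangeDependent (P : Measure Ω) (e : ℤ → Ω → E)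
    (g : ℤ → (ℕ → E) → EuclideanSpace ℝ (Fin d)) (M α : ℝ) (C : ℝ≥0) : Prop where
  measurable_innovation : ∀ t, Measurable (e t)
  indep_innovation : iIndepFun e P
  measurable_function : ∀ t, Measurable (g t)
  mean_zero : ∀ t, ∫ ω, errorSeries e g t ω ∂P = 0
  moment_le : ∀ (t : ℤ) (a : EuclideanSpace ℝ (Fin d)), ‖a‖ = 1 →
    eLpNorm (fun ω => ⟪a, errorSeries e g t ω⟫) (ENNReal.ofReal M) P ≤ C
  dependence_le : ∀ s : ℕ,
    ((1 + s : ℕ) : ℝ≥0∞) ^ α * ∑' j : ℕ, dependenceMeasure P e g M (s + j) ≤ C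

end ErrorModel

/-- The ordered pairs of times in `{1, …, T}` whose lag satisfies `B ≤ |t₁ - t₂| ≤ B₁`. -/
def lagPairs (T B B₁ : ℕ) : Finset (ℤ × ℤ) :=
  (Finset.Icc (1 : ℤ) T ×ˢ Finset.Icc (1 : ℤ) T).filter
    (fun p => (B : ℤ) ≤ |p.1 - p.2| ∧ |p.1 - p.2| ≤ (B₁ : ℤ))

/-- The normalization `V = ∑_{B ≤ |t₁ - t₂| ≤ B₁} 1`. -/
def lagCount (T B B₁ : ℕ) : ℝ := ((lagPairs T B B₁).card : ℝ)

/-- The smallest sample size `min (T_1, …, T_K)`. -/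
def minSize (K : ℕ) (T : ℕ → ℕ) : ℕ := sInf (T '' Set.Icc 1 K)

/-- The largest sample size `max (T_1, …, T_K)`. -/
def maxSize (K : ℕ) (T : ℕ → ℕ) : ℕ := (Finset.Icc 1 K).sup T

section Statistic

variable {d : ℕ}

/-- The statistic `R̂_k` comparing population `k` with population `1`, as a function of the data
`x k t`, `1 ≤ t ≤ T k`. -/
def pairStatistic (T : ℕ → ℕ) (B B₁ : ℕ) (x : ℕ → ℤ → EuclideanSpace ℝ (Fin d)) (k : ℕ) : ℝ :=
  1 / (lagCount (T k) B B₁ * √(d : ℝ)) * ∑ p ∈ lagPairs (T k) B B₁, ⟪x k p.1, x k p.2⟫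
    + 1 / (lagCount (T 1) B B₁ * √(d : ℝ)) * ∑ p ∈ lagPairs (T 1) B B₁, ⟪x 1 p.1, x 1 p.2⟫
    - 2 / ((T k : ℝ) * (T 1 : ℝ) * √(d : ℝ)) *
        ∑ t₁ ∈ Finset.Icc (1 : ℤ) (T k), ∑ t₂ ∈ Finset.Icc (1 : ℤ) (T 1), ⟪x k t₁, x 1 t₂⟫

/-- The test statistic `R̂ = ∑_{k=2}^K R̂_k`. -/
def testStatistic (K : ℕ) (T : ℕ → ℕ) (B B₁ : ℕ) (x : ℕ → ℤ → EuclideanSpace ℝ (Fin d)) : ℝ :=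
  ∑ k ∈ Finset.Icc 2 K, pairStatistic T B B₁ x k

/-- The observations `x_{t,k} = μ_k + ε_{t,k}`. -/
def observation {Ω E : Type*} (μ : ℕ → EuclideanSpace ℝ (Fin d)) (e : ℕ → ℤ → Ω → E)
    (g : ℕ → ℤ → (ℕ → E) → EuclideanSpace ℝ (Fin d)) (ω : Ω) (k : ℕ) (t : ℤ) :
    EuclideanSpace ℝ (Fin d) :=
  μ k + errorSeries (e k) (g k) t ω

/-- The normalized statistic `√(T∘ (B₁ - B)) R̂`, where `T∘` is the smallest sample size. -/
def scaledStatistic (K : ℕ) (T : ℕ → ℕ) (B B₁ : ℕ)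
    (x : ℕ → ℤ → EuclideanSpace ℝ (Fin d)) : ℝ :=
  √((minSize K T : ℝ) * ((B₁ : ℝ) - B)) * testStatistic K T B B₁ x

/-- The total squared separation `∑_{k=2}^K |μ_k - μ_1|₂²` of the means. -/
def separation (K : ℕ) (μ : ℕ → EuclideanSpace ℝ (Fin d)) : ℝ :=
  ∑ k ∈ Finset.Icc 2 K, ‖μ k - μ 1‖ ^ 2

/-- The normalized, centred quadratic form
`√(T∘ (B₁ - B)) / (V_k √d) * ∑_{B ≤ |t₁ - t₂| ≤ B₁} (ε_{t₁,k}ᵀ ε_{t₂,k} - E[ε_{t₁,k}ᵀ ε_{t₂,k}])`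
of the errors of population `k`. -/
def errorQuadraticForm {Ω E : Type*} [MeasurableSpace Ω] (P : Measure Ω) (K : ℕ) (T : ℕ → ℕ)
    (B B₁ : ℕ) (e : ℕ → ℤ → Ω → E) (g : ℕ → ℤ → (ℕ → E) → EuclideanSpace ℝ (Fin d))
    (k : ℕ) (ω : Ω) : ℝ :=
  √((minSize K T : ℝ) * ((B₁ : ℝ) - B)) / (lagCount (T k) B B₁ * √(d : ℝ)) *
    ∑ p ∈ lagPairs (T k) B B₁,
      (⟪errorSeries (e k) (g k) p.1 ω, errorSeries (e k) (g k) p.2 ω⟫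
        - ∫ ω', ⟪errorSeries (e k) (g k) p.1 ω', errorSeries (e k) (g k) p.2 ω'⟫ ∂P)

/-- The total variance
`∑_{k=2}^K Var (Q_k) + (K - 1)² Var (Q_1)` of the normalized quadratic forms of the errors. -/
def totalVariance {Ω E : Type*} [MeasurableSpace Ω] (P : Measure Ω) (K : ℕ) (T : ℕ → ℕ)
    (B B₁ : ℕ) (e : ℕ → ℤ → Ω → E) (g : ℕ → ℤ → (ℕ → E) → EuclideanSpace ℝ (Fin d)) : ℝ :=
  ∑ k ∈ Finset.Icc 2 K, variance (errorQuadraticForm P K T B B₁ e g k) P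
    + ((K : ℝ) - 1) ^ 2 * variance (errorQuadraticForm P K T B B₁ e g 1) P

end Statistic

end TimeSeriesAnova

end

/-! Expanding the inner products around the means gives `√d R̂_k = ‖μ_k - μ_1‖² + N_k`, where `N_k`
(`pairNoise`) has `L^{M/2}` norm bounded uniformly in the experiment (`eLpNorm_pairNoise_le`). Hence
`√d R̂ = Δ + N` with `‖N‖_{M/2} = O(1)`. The event `√(T∘(B₁-B)) R̂ ≤ γ` forces `|N|` to be at least
a constant multiple of `x = √T∘ (Δ/√d - γ/√(T∘(B₁-B)))`, and Markov's inequality for the moment of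
order `M/2` gives the bound `C / x^{M/2}`. As `d ≍ T∘` and `B₁ - B ≥ 1`, `x ≥ Δ/√c - γ` tends to
infinity; this yields the other two claims.

The noise is bounded term by term. Write `T` for a sample size and `L = B₁ + 1 - B` for the number
of admissible lags. A linear term `⟪μ, weighted mean of errors⟫` is of order `‖μ‖/√T`, which is
bounded since `‖μ‖ = O(√d)`. The inner product of two sample means is at most the product of their
norms, each of order `√(d/T)`. In the lagged quadratic form, `ε_t` is paired with the sum of later
errors at lags in `[B, B₁]`. Averaging out of that sum all innovations up to time `t` makes it
independent of `ε_t`; within a residue class of `t` modulo `B₁` the products are then martingale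
differences, and after normalization they contribute `√(B₁/L) √(d/T)`. The averaging error is of
order `d (1+B)^(-α)`, bounded because `κ₁ α > 1`. It also absorbs the nonzero expectation of the
quadratic form, so no centring is needed.

The probabilistic tools are built on the product space of innovation sequences. Conditional
expectations are integrals over the forgotten coordinates (`coordAvg`). A causal process telescopes
into increments, each revealing one more innovation from the past; at a fixed lag they are
martingale differences in reversed time, so a Burkholder inequality
(`eLpNorm_sum_le_of_integral_oddPow_eq_zero`) bounds weighted sums by the `ℓ²` norm of the weights
times `∑ δ_j`. -/

namespace TimeSeriesAnova

/-! ### Mixing the coordinates of two configurations -/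

section Splice

variable {ι E F : Type*}

open Classical in
/-- The configuration that agrees with `x` on `S` and with `y` off `S`. -/
noncomputable def splice (S : Set ι) (x y : ι → E) : ι → E := fun i => if i ∈ S then x i else y i

lemma splice_apply_of_mem {S : Set ι} {i : ι} (h : i ∈ S) (x y : ι → E) :
    splice S x y i = x i := by simp [splice, h]

lemma splice_apply_of_notMem {S : Set ι} {i : ι} (h : i ∉ S) (x y : ι → E) :
    splice S x y i = y i := by simp [splice, h]

lemma splice_splice (S S' : Set ι) (x y z : ι → E) :
    splice S' (splice S x y) z = splice (S ∩ S') x (splice S' y z) := by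
  ext i
  by_cases h : i ∈ S <;> by_cases h' : i ∈ S' <;> simp [splice, h, h']

lemma _root_.DependsOn.splice_left {S : Set ι} {f : (ι → E) → F} (hf : DependsOn f S) (x y : ι → E) :
    f (splice S x y) = f x := hf fun _ hi => splice_apply_of_mem hi x y

lemma _root_.DependsOn.splice_right {S S' : Set ι} {f : (ι → E) → F} (hf : DependsOn f S')
    (hS : Disjoint S S') (x y : ι → E) : f (splice S x y) = f y :=
  hf fun _ hi => splice_apply_of_notMem (fun h => Set.disjoint_left.1 hS h hi) x y

variable [MeasurableSpace E]

@[fun_prop]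
lemma measurable_splice (S : Set ι) :
    Measurable fun p : (ι → E) × (ι → E) => splice S p.1 p.2 := by
  refine measurable_pi_lambda _ fun i => ?_
  by_cases h : i ∈ S
  · simp only [splice, h, if_true]; fun_prop
  · simp only [splice, h, if_false]; fun_prop

lemma measurable_cylinderEvents_splice (S : Set ι) (y : ι → E) :
    Measurable[cylinderEvents S] fun x => splice S x y := by
  refine @measurable_pi_lambda _ _ _ (cylinderEvents S) _ _ fun i => ?_
  by_cases h : i ∈ S
  · simp only [splice, h, if_true]
    exact measurable_cylinderEvent_apply h
  · simp only [splice, h, if_false]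
    exact measurable_const

variable (ν : ι → Measure E) [∀ i, IsProbabilityMeasure (ν i)]

/-- The preimage of a box is a product of two boxes, one constraining the coordinates in `S` and one
those outside, so the two masses multiply to that of the original box. All uses of independence
below pass through this fact. -/
lemma measurePreserving_splice (S : Set ι) :
    MeasurePreserving (fun p : (ι → E) × (ι → E) => splice S p.1 p.2)
      ((Measure.infinitePi ν).prod (Measure.infinitePi ν)) (Measure.infinitePi ν) := by
  classical
  refine ⟨measurable_splice S, Measure.eq_infinitePi _ fun s t ht => ?_⟩
  have hpre : (fun p : (ι → E) × (ι → E) => splice S p.1 p.2) ⁻¹' (Set.pi s t)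
      = (Set.pi (s.filter (· ∈ S) : Finset ι) t) ×ˢ (Set.pi (s.filter (· ∉ S) : Finset ι) t) := by
    ext p
    simp only [Set.mem_preimage, Set.mem_pi, Set.mem_prod, Finset.mem_coe, Finset.mem_filter]
    constructor
    · intro h
      exact ⟨fun i hi => by simpa [splice, hi.2] using h i hi.1,
        fun i hi => by simpa [splice, hi.2] using h i hi.1⟩
    · rintro ⟨h₁, h₂⟩ i hi
      by_cases hS : i ∈ S
      · simpa [splice, hS] using h₁ i ⟨hi, hS⟩
      · simpa [splice, hS] using h₂ i ⟨hi, hS⟩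
  rw [Measure.map_apply (measurable_splice S)
    (MeasurableSet.pi s.countable_toSet fun i _ => ht i), hpre, Measure.prod_prod,
    Measure.infinitePi_pi _ fun i _ => ht i, Measure.infinitePi_pi _ fun i _ => ht i,
    Finset.prod_filter_mul_prod_filter_not]

end Splice

/-! ### Conditional expectation as partial integration on a product space -/

section CoordAvg

variable {ι E F : Type*} [MeasurableSpace E] [NormedAddCommGroup F] [NormedSpace ℝ F]
  (ν : ι → Measure E) [∀ i, IsProbabilityMeasure (ν i)]

/-- The average of `f` over the coordinates outside `S`: the conditional expectation of `f` given
the coordinates in `S`. -/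
noncomputable def coordAvg (S : Set ι) (f : (ι → E) → F) (x : ι → E) : F :=
  ∫ y, f (splice S x y) ∂(Measure.infinitePi ν)

omit [∀ i, IsProbabilityMeasure (ν i)] in
lemma dependsOn_coordAvg (S : Set ι) (f : (ι → E) → F) : DependsOn (coordAvg ν S f) S := by
  intro x x' h
  have : ∀ y, splice S x y = splice S x' y := fun y => by
    ext i
    by_cases hi : i ∈ S
    · simp [splice, hi, h i hi]
    · simp [splice, hi]
  simp [coordAvg, this]

lemma stronglyMeasurable_coordAvg (S : Set ι) {f : (ι → E) → F} (hf : StronglyMeasurable f) :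
    StronglyMeasurable (coordAvg ν S f) :=
  StronglyMeasurable.integral_prod_right (f := fun x y => f (splice S x y))
    (hf.comp_measurable (measurable_splice S))

omit [∀ i, IsProbabilityMeasure (ν i)] in
lemma coordAvg_empty (f : (ι → E) → F) (x : ι → E) : coordAvg ν ∅ f x = ∫ y, f y ∂(Measure.infinitePi ν) := by
  have : ∀ y, splice ∅ x y = y := fun y => by ext i; simp [splice]
  simp [coordAvg, this]

variable {ν}

omit [NormedSpace ℝ F] in
lemma integrable_splice (S : Set ι) {f : (ι → E) → F} (hf : Integrable f (Measure.infinitePi ν)) :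
    Integrable (fun p : (ι → E) × (ι → E) => f (splice S p.1 p.2)) ((Measure.infinitePi ν).prod (Measure.infinitePi ν)) :=
  (measurePreserving_splice ν S).integrable_comp_of_integrable hf

omit [NormedSpace ℝ F] in
lemma ae_integrable_splice (S : Set ι) {f : (ι → E) → F} (hf : Integrable f (Measure.infinitePi ν)) :
    ∀ᵐ x ∂(Measure.infinitePi ν), Integrable (fun y => f (splice S x y)) (Measure.infinitePi ν) :=
  (integrable_splice S hf).prod_right_ae

lemma integrable_coordAvg (S : Set ι) {f : (ι → E) → F} (hf : Integrable f (Measure.infinitePi ν)) :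
    Integrable (coordAvg ν S f) (Measure.infinitePi ν) := (integrable_splice S hf).integral_prod_left

lemma integral_coordAvg (S : Set ι) {f : (ι → E) → F} (hf : Integrable f (Measure.infinitePi ν)) :
    ∫ x, coordAvg ν S f x ∂(Measure.infinitePi ν) = ∫ x, f x ∂(Measure.infinitePi ν) := by
  have h := integral_prod _ (integrable_splice S hf)
  have h' := integral_map (μ := (Measure.infinitePi ν).prod (Measure.infinitePi ν))
    (measurable_splice S).aemeasurable (f := f) (by
      rw [(measurePreserving_splice ν S).map_eq]; exact hf.aestronglyMeasurable)
  rw [(measurePreserving_splice ν S).map_eq] at h'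
  rw [h', h]
  rfl

/-- Conditional expectations over coordinate sets of a product measure commute: splicing twice
retains only the coordinates in both sets, and the two independent fillings amount to a single one.
Unlike the general tower property, the sets need not be nested. -/
lemma coordAvg_coordAvg (S S' : Set ι) {f : (ι → E) → F} (hf : Integrable f (Measure.infinitePi ν)) :
    coordAvg ν S (coordAvg ν S' f) =ᵐ[Measure.infinitePi ν] coordAvg ν (S ∩ S') f := by
  filter_upwards [ae_integrable_splice (S ∩ S') hf] with x hx
  have h : ∀ y z, f (splice S' (splice S x y) z) = f (splice (S ∩ S') x (splice S' y z)) :=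
    fun y z => by rw [splice_splice]
  simp only [coordAvg, h]
  exact integral_coordAvg S' hx

lemma integral_mul_coordAvg {U : Set ι} {h f : (ι → E) → ℝ} (hh : DependsOn h U)
    (hint : Integrable (fun x => h x * f x) (Measure.infinitePi ν)) :
    ∫ x, h x * f x ∂(Measure.infinitePi ν) = ∫ x, h x * coordAvg ν U f x ∂(Measure.infinitePi ν) := by
  rw [← integral_coordAvg U hint]
  simp [coordAvg, hh.splice_left, integral_const_mul]

lemma coordAvg_sub (S : Set ι) {f g : (ι → E) → F} (hf : Integrable f (Measure.infinitePi ν)) (hg : Integrable g (Measure.infinitePi ν)) :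
    coordAvg ν S (fun x => f x - g x) =ᵐ[Measure.infinitePi ν] fun x => coordAvg ν S f x - coordAvg ν S g x := by
  filter_upwards [ae_integrable_splice S hf, ae_integrable_splice S hg] with x hx hx'
  exact integral_sub hx hx'

lemma coordAvg_inner {d : ℕ} (S : Set ι) {f : (ι → E) → EuclideanSpace ℝ (Fin d)}
    (hf : Integrable f (Measure.infinitePi ν)) (a : EuclideanSpace ℝ (Fin d)) :
    coordAvg ν S (fun x => ⟪a, f x⟫) =ᵐ[Measure.infinitePi ν] fun x => ⟪a, coordAvg ν S f x⟫ := by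
  filter_upwards [ae_integrable_splice S hf] with x hx
  exact integral_inner hx a

/-- Jensen's inequality for a partial integral. -/
lemma eLpNorm_integral_prod_le {α β : Type*} [MeasurableSpace α] [MeasurableSpace β]
    {P : Measure α} {Q : Measure β} [SFinite P] [IsProbabilityMeasure Q] {f : α × β → F}
    (hf : StronglyMeasurable f) {p : ℝ} (hp : 1 ≤ p) :
    eLpNorm (fun x => ∫ y, f (x, y) ∂Q) (ENNReal.ofReal p) P
      ≤ eLpNorm f (ENNReal.ofReal p) (P.prod Q) := by
  have hp0 : 0 < p := by linarith
  have h1 : ENNReal.ofReal p ≠ 0 := by simpa using hp0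
  rw [eLpNorm_eq_lintegral_rpow_enorm_toReal h1 ENNReal.ofReal_ne_top,
    eLpNorm_eq_lintegral_rpow_enorm_toReal h1 ENNReal.ofReal_ne_top,
    lintegral_prod _ (by fun_prop), ENNReal.toReal_ofReal hp0.le]
  gcongr with x
  have hx : AEStronglyMeasurable (fun y => f (x, y)) Q :=
    (hf.comp_measurable measurable_prodMk_left).aestronglyMeasurable
  have h2 : ‖∫ y, f (x, y) ∂Q‖ₑ ≤ eLpNorm (fun y => f (x, y)) (ENNReal.ofReal p) Q :=
    calc _ ≤ ∫⁻ y, ‖f (x, y)‖ₑ ∂Q := enorm_integral_le_lintegral_enorm _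
      _ = eLpNorm (fun y => f (x, y)) 1 Q := eLpNorm_one_eq_lintegral_enorm.symm
      _ ≤ _ := eLpNorm_le_eLpNorm_of_exponent_le (by simpa using hp) hx
  calc _ ≤ (eLpNorm (fun y => f (x, y)) (ENNReal.ofReal p) Q) ^ p := by gcongr
    _ = _ := by
      rw [eLpNorm_eq_lintegral_rpow_enorm_toReal h1 ENNReal.ofReal_ne_top,
        ENNReal.toReal_ofReal hp0.le, ← ENNReal.rpow_mul]
      simp [hp0.ne']

lemma eLpNorm_coordAvg_le (S : Set ι) {f : (ι → E) → F} (hf : StronglyMeasurable f)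
    {p : ℝ} (hp : 1 ≤ p) :
    eLpNorm (coordAvg ν S f) (ENNReal.ofReal p) (Measure.infinitePi ν) ≤ eLpNorm f (ENNReal.ofReal p) (Measure.infinitePi ν) := by
  refine (eLpNorm_integral_prod_le (f := fun q => f (splice S q.1 q.2))
    (hf.comp_measurable (measurable_splice S)) hp).trans_eq ?_
  exact eLpNorm_comp_measurePreserving (hf.aestronglyMeasurable) (measurePreserving_splice ν S)

/-- Revealing the coordinate `i` on top of `S` changes the conditional expectation of `f` by at
most the effect of resampling the coordinate `i`. -/
lemma eLpNorm_coordAvg_insert_sub_le {S : Set ι} {i : ι} (hi : i ∉ S) {f : (ι → E) → ℝ}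
    (hf : StronglyMeasurable f) (hint : Integrable f (Measure.infinitePi ν)) {p : ℝ} (hp : 1 ≤ p) :
    eLpNorm (fun x => coordAvg ν (insert i S) f x - coordAvg ν S f x) (ENNReal.ofReal p) (Measure.infinitePi ν)
      ≤ eLpNorm (fun q : (ι → E) × (ι → E) => f q.1 - f (splice {i}ᶜ q.1 q.2))
          (ENNReal.ofReal p) ((Measure.infinitePi ν).prod (Measure.infinitePi ν)) := by
  have hG : StronglyMeasurable fun x => f x - coordAvg ν {i}ᶜ f x :=
    hf.sub (stronglyMeasurable_coordAvg ν _ hf)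
  -- Forgetting `i` first and then keeping `insert i S` leaves exactly `S`, so the difference is one
  -- conditional expectation of `f - coordAvg ν {i}ᶜ f`, and Jensen applies to it.
  have h1 : (fun x => coordAvg ν (insert i S) f x - coordAvg ν S f x)
      =ᵐ[Measure.infinitePi ν] coordAvg ν (insert i S) (fun x => f x - coordAvg ν {i}ᶜ f x) := by
    filter_upwards [coordAvg_sub (insert i S) hint (integrable_coordAvg {i}ᶜ hint),
      coordAvg_coordAvg (insert i S) {i}ᶜ hint] with x hx hx'
    have hS : insert i S ∩ {i}ᶜ = S := by
      ext j
      by_cases hj : j = i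
      · subst hj; simp [hi]
      · simp [hj]
    rw [hx, hx', hS]
  rw [eLpNorm_congr_ae h1]
  refine (eLpNorm_coordAvg_le _ hG hp).trans ?_
  have h2 : (fun x => f x - coordAvg ν {i}ᶜ f x)
      =ᵐ[Measure.infinitePi ν] fun x => ∫ y, (f x - f (splice {i}ᶜ x y)) ∂(Measure.infinitePi ν) := by
    filter_upwards [ae_integrable_splice {i}ᶜ hint] with x hx
    rw [integral_sub (integrable_const _) hx]
    simp [coordAvg]
  rw [eLpNorm_congr_ae h2]
  exact eLpNorm_integral_prod_le (f := fun q => f q.1 - f (splice {i}ᶜ q.1 q.2))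
    ((hf.comp_measurable measurable_fst).sub (hf.comp_measurable (measurable_splice _))) hp

lemma measurable_cylinderEvents_of_dependsOn {S : Set ι} {G : Type*} [MeasurableSpace G]
    [Nonempty (ι → E)] {f : (ι → E) → G} (hf : Measurable f) (hS : DependsOn f S) :
    Measurable[cylinderEvents S] f := by
  obtain ⟨c⟩ := ‹Nonempty (ι → E)›
  have : f = f ∘ fun x => splice S x c := by
    ext x; exact (hS.splice_left x c).symm
  rw [this]
  exact hf.comp (measurable_cylinderEvents_splice S c)

/-- The link with abstract conditional expectation gives access to martingale convergence. Events of
the cylinder σ-algebra depend only on the coordinates in `S`, so their indicators pass through the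
average. -/
lemma coordAvg_ae_eq_condExp (S : Set ι) {f : (ι → E) → ℝ} (hf : Measurable f)
    (hint : Integrable f (Measure.infinitePi ν)) : coordAvg ν S f =ᵐ[Measure.infinitePi ν] (Measure.infinitePi ν)[f | cylinderEvents S] := by
  have : Nonempty (ι → E) := (Measure.infinitePi ν).nonempty_of_neZero
  refine ae_eq_condExp_of_forall_setIntegral_eq cylinderEvents_le_pi hint
    (fun s _ _ => (integrable_coordAvg S hint).integrableOn) (fun s hs _ => ?_) ?_
  · have hs' : MeasurableSet s := cylinderEvents_le_pi s hs
    have hmem : DependsOn (s.indicator fun _ => (1 : ℝ)) S := by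
      intro x y hxx
      have h2 : x ∈ s ↔ y ∈ s := by
        have h3 : cylinderEvents (X := fun _ : ι => E) S
            ≤ MeasurableSpace.comap (S.domRestrict (π := fun _ : ι => E)) MeasurableSpace.pi := by
          refine iSup₂_le fun i hi => ?_
          rintro _ ⟨u, hu, rfl⟩
          exact ⟨(fun z : S → E => z ⟨i, hi⟩) ⁻¹' u, (measurable_pi_apply _) hu, rfl⟩
        obtain ⟨u, -, rfl⟩ := h3 s hs
        have : S.domRestrict x = S.domRestrict y := by
          ext i; exact hxx i i.2
        simp [Set.mem_preimage, this]
      by_cases hx : x ∈ s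
      · simp [hx, h2.1 hx]
      · simp [hx, mt h2.2 hx]
    have hmul : ∀ F : (ι → E) → ℝ,
        (fun x => s.indicator (fun _ => (1 : ℝ)) x * F x) = s.indicator F := fun F => by
      ext x; by_cases hx : x ∈ s <;> simp [hx]
    have key := integral_mul_coordAvg (ν := ν) hmem (f := f) (by
      rw [hmul]; exact hint.indicator hs')
    rw [hmul, hmul] at key
    rw [← integral_indicator hs', ← integral_indicator hs', key]
  · exact (measurable_cylinderEvents_of_dependsOn
      (stronglyMeasurable_coordAvg ν S hf.stronglyMeasurable).measurable
      (dependsOn_coordAvg ν S f)).stronglyMeasurable.aestronglyMeasurable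

/-- Lévy's upward theorem for averages over coordinates. -/
lemma tendsto_coordAvg {S : ℕ → Set ι} (hS : Monotone S) {f : (ι → E) → ℝ} (hf : Measurable f)
    (hint : Integrable f (Measure.infinitePi ν)) (hdep : DependsOn f (⋃ n, S n)) :
    ∀ᵐ x ∂(Measure.infinitePi ν), Tendsto (fun n => coordAvg ν (S n) f x) atTop (𝓝 (f x)) := by
  have : Nonempty (ι → E) := (Measure.infinitePi ν).nonempty_of_neZero
  let ℱ : Filtration ℕ (MeasurableSpace.pi (X := fun _ : ι => E)) :=
    ⟨fun n => cylinderEvents (S n), fun _ _ h => cylinderEvents_mono (hS h),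
      fun _ => cylinderEvents_le_pi⟩
  have hsup : (⨆ n, ℱ n) = cylinderEvents (X := fun _ : ι => E) (⋃ n, S n) := by
    refine le_antisymm (iSup_le fun n => cylinderEvents_mono (Set.subset_iUnion S n)) ?_
    refine iSup₂_le fun i hi => ?_
    obtain ⟨n, hn⟩ := Set.mem_iUnion.1 hi
    exact le_trans (le_iSup₂ (f := fun i (_ : i ∈ S n) =>
      MeasurableSpace.comap (fun σ : ι → E => σ i) inferInstance) i hn) (le_iSup (fun n => ℱ n) n)
  have hlim := tendsto_ae_condExp (μ := (Measure.infinitePi ν)) (ℱ := ℱ) f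
  have hfm : StronglyMeasurable[⨆ n, ℱ n] f := by
    rw [hsup]
    exact (measurable_cylinderEvents_of_dependsOn hf hdep).stronglyMeasurable
  rw [condExp_of_stronglyMeasurable (iSup_le fun n => ℱ.le n) hfm hint] at hlim
  have hae : ∀ᵐ x ∂(Measure.infinitePi ν), ∀ n, coordAvg ν (S n) f x = ((Measure.infinitePi ν)[f | ℱ n]) x :=
    ae_all_iff.2 fun n => coordAvg_ae_eq_condExp (S n) hf hint
  filter_upwards [hlim, hae] with x hx hx'
  simpa only [hx'] using hx

end CoordAvg

/-! ### A Burkholder inequality from the second-order expansion of `|s + y|^p` -/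

section Burkholder

/-- The odd power `s ↦ |s|^{p-2} s`, a multiple of the derivative of `|s|^p`. -/
noncomputable def oddPow (p s : ℝ) : ℝ := |s| ^ (p - 2) * s

lemma oddPow_neg (p s : ℝ) : oddPow p (-s) = -oddPow p s := by simp [oddPow]

lemma measurable_oddPow (p : ℝ) : Measurable (oddPow p) := by unfold oddPow; fun_prop

lemma abs_oddPow {p : ℝ} (hp : 2 < p) (s : ℝ) : |oddPow p s| = |s| ^ (p - 1) := by
  rw [oddPow, abs_mul, abs_of_nonneg (by positivity)]
  rcases eq_or_ne s 0 with rfl | hs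
  · rw [abs_zero, Real.zero_rpow (by linarith), Real.zero_rpow (by linarith), zero_mul]
  · rw [← Real.rpow_add_one (abs_ne_zero.2 hs)]; ring_nf

lemma oddPow_mul_self {p : ℝ} (hp : 2 < p) (s : ℝ) : oddPow p s * s = |s| ^ p := by
  have h : oddPow p s * s = |s| ^ (p - 2) * |s| * |s| := by
    rw [oddPow, mul_assoc, mul_assoc, abs_mul_abs_self]
  rw [h]
  rcases eq_or_ne s 0 with rfl | hs
  · simp [Real.zero_rpow (by linarith : p ≠ 0)]
  · rw [← Real.rpow_add_one (abs_ne_zero.2 hs), ← Real.rpow_add_one (abs_ne_zero.2 hs)]; ring_nf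

lemma rpow_sub_rpow_le {q a b : ℝ} (hq : 1 ≤ q) (ha : 0 ≤ a) (hab : a ≤ b) :
    b ^ q - a ^ q ≤ q * b ^ (q - 1) * (b - a) := by
  rcases (ha.trans hab).eq_or_lt with hb | hb
  · have : a = 0 := by linarith
    subst this; simp [← hb]
  have h := one_add_mul_self_le_rpow_one_add (s := a / b - 1) (p := q)
    (by have := div_nonneg ha hb.le; linarith) hq
  rw [add_sub_cancel, Real.div_rpow ha hb.le, le_div_iff₀ (by positivity)] at h
  have h2 : b ^ q = b ^ (q - 1) * b := by
    rw [← Real.rpow_add_one hb.ne']; ring_nf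
  have h3 : (1 + q * (a / b - 1)) * b ^ q = b ^ q - q * b ^ (q - 1) * (b - a) := by
    rw [h2]; field_simp; ring
  linarith

/-- A mean value bound, since the derivative of the odd power is `(p-1)|·|^(p-2)`. For equal signs
it reduces to Bernoulli's inequality; for opposite signs the absolute values add up and `p - 1 ≥ 1`
suffices. -/
lemma abs_oddPow_sub_le {p : ℝ} (hp : 2 < p) (s u : ℝ) :
    |oddPow p u - oddPow p s| ≤ (p - 1) * max |u| |s| ^ (p - 2) * |u - s| := by
  have hpos : ∀ a b : ℝ, 0 ≤ a → a ≤ b →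
      |oddPow p b - oddPow p a| ≤ (p - 1) * max |b| |a| ^ (p - 2) * |b - a| := by
    intro a b ha hab
    have hb := ha.trans hab
    have e : ∀ c : ℝ, 0 ≤ c → oddPow p c = c ^ (p - 1) := fun c hc => by
      rw [← abs_of_nonneg (a := oddPow p c) (by unfold oddPow; positivity), abs_oddPow hp,
        abs_of_nonneg hc]
    rw [e a ha, e b hb, abs_of_nonneg ha, abs_of_nonneg hb, max_eq_left hab,
      abs_of_nonneg (sub_nonneg.2 hab),
      abs_of_nonneg (sub_nonneg.2 (Real.rpow_le_rpow ha hab (by linarith)))]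
    have := rpow_sub_rpow_le (q := p - 1) (by linarith) ha hab
    rwa [show p - 1 - 1 = p - 2 by ring] at this
  have hneg : ∀ a b : ℝ, 0 ≤ a → 0 ≤ b →
      |oddPow p b - oddPow p (-a)| ≤ (p - 1) * max |b| |(-a)| ^ (p - 2) * |b - (-a)| := by
    intro a b ha hb
    rw [oddPow_neg, abs_neg, sub_neg_eq_add, sub_neg_eq_add, oddPow, oddPow, abs_of_nonneg ha,
      abs_of_nonneg hb, abs_of_nonneg (by positivity), abs_of_nonneg (by positivity)]
    have h1 : b ^ (p - 2) ≤ max b a ^ (p - 2) :=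
      Real.rpow_le_rpow hb (le_max_left _ _) (by linarith)
    have h2 : a ^ (p - 2) ≤ max b a ^ (p - 2) :=
      Real.rpow_le_rpow ha (le_max_right _ _) (by linarith)
    calc b ^ (p - 2) * b + a ^ (p - 2) * a
        ≤ max b a ^ (p - 2) * b + max b a ^ (p - 2) * a := by gcongr
      _ = 1 * max b a ^ (p - 2) * (b + a) := by ring
      _ ≤ _ := by gcongr; linarith
  have hnn : ∀ a b : ℝ, 0 ≤ a → 0 ≤ b →
      |oddPow p b - oddPow p a| ≤ (p - 1) * max |b| |a| ^ (p - 2) * |b - a| := by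
    intro a b ha hb
    rcases le_total a b with h | h
    · exact hpos a b ha h
    · rw [abs_sub_comm, max_comm, abs_sub_comm b a]; exact hpos b a hb h
  rcases le_total 0 s with hs | hs <;> rcases le_total 0 u with hu | hu
  · exact hnn s u hs hu
  · have := hneg (-u) s (by linarith) hs
    rw [neg_neg] at this
    rw [abs_sub_comm, max_comm, abs_sub_comm u s]; exact this
  · have := hneg (-s) u (by linarith) hu
    rwa [neg_neg] at this
  · have := hnn (-s) (-u) (by linarith) (by linarith)
    rw [oddPow_neg, oddPow_neg, abs_neg, abs_neg, ← abs_neg] at this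
    rw [← abs_neg (u - s)]
    convert this using 2 <;> ring_nf

lemma rpow_add_le {q a b : ℝ} (hq : 0 ≤ q) (ha : 0 ≤ a) (hb : 0 ≤ b) :
    (a + b) ^ q ≤ 2 ^ q * (a ^ q + b ^ q) := by
  have h : a + b ≤ 2 * max a b := by
    rcases le_total a b with h | h <;> simp [h] <;> linarith
  calc (a + b) ^ q ≤ (2 * max a b) ^ q := Real.rpow_le_rpow (by positivity) h hq
    _ = 2 ^ q * max a b ^ q := Real.mul_rpow (by norm_num) (by positivity)
    _ ≤ _ := by
      gcongr
      rcases le_total a b with h | h <;> simp [h] <;> positivity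

/-- The constant in the second-order expansion of `|s + y|^p`. -/
noncomputable def expansionConst (p : ℝ) : ℝ := p * (p - 1) * 2 ^ (p - 2) * 2

lemma abs_add_rpow_le {p : ℝ} (hp : 2 < p) (s y : ℝ) :
    |s + y| ^ p ≤ |s| ^ p + p * (oddPow p s * y)
      + expansionConst p * (|s| ^ (p - 2) * |y| ^ (2 : ℝ) + |y| ^ p) := by
  set u := s + y with hu
  have hy : y = u - s := by rw [hu]; ring
  -- The tangent line to the convex function `|·|^p` at `u = s + y`, evaluated at `s`; Young's
  -- inequality proves it. Replacing `oddPow p u` by `oddPow p s` in `h2` costs only second-order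
  -- terms.
  have h1 : |u| ^ p ≤ |s| ^ p + p * (oddPow p u * y) := by
    have hY := Real.young_inequality_of_nonneg (a := |s|) (b := |u| ^ (p - 1)) (p := p)
      (q := p / (p - 1)) (abs_nonneg s) (by positivity)
      (Real.HolderConjugate.conjExponent (by linarith))
    rw [← Real.rpow_mul (abs_nonneg u), mul_div_cancel₀ _ (by linarith : p - 1 ≠ 0)] at hY
    have h3 : oddPow p u * s ≤ |s| * |u| ^ (p - 1) := by
      calc _ ≤ |oddPow p u * s| := le_abs_self _
        _ = _ := by rw [abs_mul, abs_oddPow hp, mul_comm]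
    have h4 : oddPow p u * y = |u| ^ p - oddPow p u * s := by
      rw [hy, mul_sub, oddPow_mul_self hp]
    have h5 : p * (|s| ^ p / p + |u| ^ p / (p / (p - 1))) = |s| ^ p + (p - 1) * |u| ^ p := by
      field_simp
    have h6 : p * (oddPow p u * s) ≤ |s| ^ p + (p - 1) * |u| ^ p := by
      rw [← h5]; gcongr; exact h3.trans hY
    rw [h4]; linarith
  have h2 : oddPow p u * y ≤ oddPow p s * y
      + (p - 1) * (2 ^ (p - 2) * (|s| ^ (p - 2) + |y| ^ (p - 2))) * |y| * |y| := by
    have h3 := abs_oddPow_sub_le hp s u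
    rw [← hy] at h3
    have h4 : max |u| |s| ^ (p - 2) ≤ 2 ^ (p - 2) * (|s| ^ (p - 2) + |y| ^ (p - 2)) := by
      refine le_trans ?_ (rpow_add_le (by linarith) (abs_nonneg s) (abs_nonneg y))
      refine Real.rpow_le_rpow (by positivity) ?_ (by linarith)
      exact max_le (abs_add_le s y) (by linarith [abs_nonneg y])
    have h5 : (oddPow p u - oddPow p s) * y ≤ |oddPow p u - oddPow p s| * |y| :=
      (le_abs_self _).trans_eq (abs_mul _ _)
    have h6 : |oddPow p u - oddPow p s| * |y|
        ≤ (p - 1) * (2 ^ (p - 2) * (|s| ^ (p - 2) + |y| ^ (p - 2))) * |y| * |y| := by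
      refine mul_le_mul_of_nonneg_right (h3.trans ?_) (abs_nonneg y)
      have : 0 ≤ p - 1 := by linarith
      gcongr
    linarith [sub_mul (oddPow p u) (oddPow p s) y]
  have h7 : |y| ^ (p - 2) * |y| * |y| = |y| ^ p := by
    rw [mul_assoc, abs_mul_abs_self, ← oddPow_mul_self hp y, oddPow]; ring
  have h8 : |y| ^ (2 : ℝ) = |y| * |y| := by rw [Real.rpow_two, sq]
  have h9 : p * (oddPow p u * y) ≤ p * (oddPow p s * y)
      + p * (p - 1) * 2 ^ (p - 2) * (|s| ^ (p - 2) * |y| ^ (2 : ℝ) + |y| ^ p) := by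
    have := mul_le_mul_of_nonneg_left h2 (by linarith : (0 : ℝ) ≤ p)
    rw [h8, ← h7]
    linarith
  have h10 : 0 ≤ p * (p - 1) * 2 ^ (p - 2) * (|s| ^ (p - 2) * |y| ^ (2 : ℝ) + |y| ^ p) := by
    have : 0 ≤ p - 1 := by linarith
    positivity
  rw [expansionConst]
  linarith

lemma expansionConst_pos {p : ℝ} (hp : 2 < p) : 0 < expansionConst p := by
  have : 0 < p - 1 := by linarith
  unfold expansionConst; positivity

/-- The constant in the Burkholder-type inequality `eLpNorm_sum_le_of_integral_oddPow_eq_zero`. -/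
noncomputable def burkholderConst (p : ℝ) : ℝ := 2 * expansionConst p + 1

lemma burkholderConst_pos {p : ℝ} (hp : 2 < p) : 0 < burkholderConst p := by
  have := expansionConst_pos hp
  unfold burkholderConst; positivity

/-- This closes the induction on the number of summands, with `q = p/2`, `s` the sum of squared
norms so far and `b` the next square. The left side is at most the mean of two lower bounds for `(As
+ Ab)^q`, one with `(Ab)^q` and one with `(As)^(q-1) Ab`; `c ≤ A/2` lets half of each absorb the
error. -/
lemma burkholder_step {q A c s b : ℝ} (hq : 1 < q) (hc : 0 ≤ c) (hA : A = 2 * c + 1) (hs : 0 ≤ s)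
    (hb : 0 ≤ b) :
    (A * s) ^ q + c * ((A * s) ^ (q - 1) * b + b ^ q) ≤ (A * (s + b)) ^ q := by
  have hA1 : 1 ≤ A := by linarith
  have hAs : 0 ≤ A * s := by positivity
  have hAb : 0 ≤ A * b := by positivity
  have h1 : (A * s) ^ q + (A * b) ^ q ≤ (A * s + A * b) ^ q :=
    Real.add_rpow_le_rpow_add hAs hAb hq.le
  have h2 : (A * s) ^ q + (A * s) ^ (q - 1) * (A * b) ≤ (A * s + A * b) ^ q := by
    rcases hAs.eq_or_lt with h | h
    · rw [← h, Real.zero_rpow (by linarith), Real.zero_rpow (by linarith)]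
      simp only [zero_mul, add_zero]; positivity
    have e : ∀ t : ℝ, 0 < t → t ^ q = t ^ (q - 1) * t := fun t ht => by
      rw [← Real.rpow_add_one ht.ne']; ring_nf
    rw [e _ h, e _ (by positivity), ← mul_add]
    gcongr
    linarith
  have h3 : c * b ^ q ≤ (1 / 2) * (A * b) ^ q := by
    rw [Real.mul_rpow (by linarith) hb]
    have : A ≤ A ^ q := by
      simpa using Real.rpow_le_rpow_of_exponent_le hA1 hq.le
    have hbq : 0 ≤ b ^ q := by positivity
    nlinarith
  have h4 : c * ((A * s) ^ (q - 1) * b) ≤ (1 / 2) * ((A * s) ^ (q - 1) * (A * b)) := by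
    have : 0 ≤ (A * s) ^ (q - 1) * b := by positivity
    nlinarith
  rw [mul_add A s b]
  linarith

variable {Ω : Type*} [MeasurableSpace Ω] {P : Measure Ω}

lemma integrable_abs_rpow {p : ℝ} (hp : 0 < p) {f : Ω → ℝ} (hf : MemLp f (ENNReal.ofReal p) P) :
    Integrable (fun ω => |f ω| ^ p) P := by
  have := hf.integrable_norm_rpow (by simpa using hp) ENNReal.ofReal_ne_top
  simpa [ENNReal.toReal_ofReal hp.le] using this

lemma integrable_abs_rpow_mul {p a b : ℝ} (ha : 0 ≤ a) (hb : 0 ≤ b) (hab : a + b = p)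
    (hp : 0 < p) {f g : Ω → ℝ} (hf : MemLp f (ENNReal.ofReal p) P)
    (hg : MemLp g (ENNReal.ofReal p) P) : Integrable (fun ω => |f ω| ^ a * |g ω| ^ b) P := by
  refine ((integrable_abs_rpow hp hf).add (integrable_abs_rpow hp hg)).mono'
    (by have := hf.1; have := hg.1; fun_prop) (Eventually.of_forall fun ω => ?_)
  rw [Real.norm_of_nonneg (by positivity), Pi.add_apply]
  have e : ∀ t : ℝ, 0 ≤ t → t ^ p = t ^ a * t ^ b := fun t ht => by
    rw [← hab, Real.rpow_add_of_nonneg ht ha hb]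
  rcases le_total |f ω| |g ω| with h | h
  · calc _ ≤ |g ω| ^ a * |g ω| ^ b := by gcongr
      _ ≤ _ := by rw [e |g ω| (abs_nonneg _)]; linarith [Real.rpow_nonneg (abs_nonneg (f ω)) p]
  · calc _ ≤ |f ω| ^ a * |f ω| ^ b := by gcongr
      _ ≤ _ := by rw [e |f ω| (abs_nonneg _)]; linarith [Real.rpow_nonneg (abs_nonneg (g ω)) p]

lemma integrable_oddPow_mul {p : ℝ} (hp : 2 < p) {f g : Ω → ℝ}
    (hf : MemLp f (ENNReal.ofReal p) P) (hg : MemLp g (ENNReal.ofReal p) P) :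
    Integrable (fun ω => oddPow p (f ω) * g ω) P := by
  refine (integrable_abs_rpow_mul (a := p - 1) (b := 1) (by linarith) (by norm_num) (by ring)
    (by linarith) hf hg).mono' ?_ (Eventually.of_forall fun ω => ?_)
  · exact ((measurable_oddPow p).comp_aemeasurable hf.1.aemeasurable).aestronglyMeasurable.mul hg.1
  · rw [Real.norm_eq_abs, abs_mul, abs_oddPow hp, Real.rpow_one]

lemma integral_abs_rpow_mul_le {p : ℝ} (hp : 2 < p) {f g : Ω → ℝ}
    (hf : MemLp f (ENNReal.ofReal p) P) (hg : MemLp g (ENNReal.ofReal p) P) :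
    ∫ ω, |f ω| ^ (p - 2) * |g ω| ^ (2 : ℝ) ∂P
      ≤ (∫ ω, |f ω| ^ p ∂P) ^ ((p - 2) / p) * (∫ ω, |g ω| ^ p ∂P) ^ (2 / p) := by
  have hp2 : 0 < p - 2 := by linarith
  have hconj : (p / (p - 2)).HolderConjugate (p / 2) := by
    rw [Real.holderConjugate_iff]
    refine ⟨by rw [lt_div_iff₀ hp2]; linarith, ?_⟩
    field_simp; ring
  have h1 : MemLp (fun ω => |f ω| ^ (p - 2)) (ENNReal.ofReal (p / (p - 2))) P := by
    have := hf.norm_rpow_div (ENNReal.ofReal (p - 2))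
    rw [ENNReal.toReal_ofReal hp2.le, ← ENNReal.ofReal_div_of_pos hp2] at this
    exact this
  have h2 : MemLp (fun ω => |g ω| ^ (2 : ℝ)) (ENNReal.ofReal (p / 2)) P := by
    have := hg.norm_rpow_div (ENNReal.ofReal 2)
    rw [ENNReal.toReal_ofReal (by norm_num), ← ENNReal.ofReal_div_of_pos (by norm_num)] at this
    exact this
  have := integral_mul_le_Lp_mul_Lq_of_nonneg hconj
    (Eventually.of_forall fun ω => by positivity) (Eventually.of_forall fun ω => by positivity)
    h1 h2
  refine this.trans_eq ?_
  simp_rw [← Real.rpow_mul (abs_nonneg _), one_div_div]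
  rw [mul_div_cancel₀ _ hp2.ne', mul_div_cancel₀ _ (two_ne_zero)]

/-- One martingale step: after integrating the expansion of `|f + g|^p` the first-order term
vanishes by orthogonality, Hölder bounds the term `|f|^(p-2) g²`, and `burkholder_step` restores the
shape of the induction hypothesis. -/
lemma integral_abs_add_rpow_le {p S b : ℝ} (hp : 2 < p) {f g : Ω → ℝ}
    (hf : MemLp f (ENNReal.ofReal p) P) (hg : MemLp g (ENNReal.ofReal p) P) (hb : 0 ≤ b)
    (hS : 0 ≤ S) (hfS : ∫ ω, |f ω| ^ p ∂P ≤ (burkholderConst p * S) ^ (p / 2))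
    (hgb : ∫ ω, |g ω| ^ p ∂P ≤ b ^ p) (horth : ∫ ω, oddPow p (f ω) * g ω ∂P = 0) :
    ∫ ω, |f ω + g ω| ^ p ∂P ≤ (burkholderConst p * (S + b ^ 2)) ^ (p / 2) := by
  have hp0 : 0 < p := by linarith
  have hc := (expansionConst_pos hp).le
  have hA := (burkholderConst_pos hp).le
  have i1 := integrable_abs_rpow hp0 hf
  have i2 := (integrable_oddPow_mul hp hf hg).const_mul p
  have i3 := integrable_abs_rpow_mul (a := p - 2) (b := 2) (by linarith) (by norm_num) (by ring)
    hp0 hf hg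
  have i4 := integrable_abs_rpow hp0 hg
  have hle : ∫ ω, |f ω + g ω| ^ p ∂P ≤ ∫ ω, (|f ω| ^ p + p * (oddPow p (f ω) * g ω)
      + expansionConst p * (|f ω| ^ (p - 2) * |g ω| ^ (2 : ℝ) + |g ω| ^ p)) ∂P :=
    integral_mono (integrable_abs_rpow hp0 (hf.add hg))
      ((i1.add i2).add ((i3.add i4).const_mul _)) fun ω => abs_add_rpow_le hp _ _
  have heq : ∫ ω, (|f ω| ^ p + p * (oddPow p (f ω) * g ω)
      + expansionConst p * (|f ω| ^ (p - 2) * |g ω| ^ (2 : ℝ) + |g ω| ^ p)) ∂P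
      = ∫ ω, |f ω| ^ p ∂P + expansionConst p *
        (∫ ω, |f ω| ^ (p - 2) * |g ω| ^ (2 : ℝ) ∂P + ∫ ω, |g ω| ^ p ∂P) := by
    have e1 := integral_add (i1.add i2) ((i3.add i4).const_mul (expansionConst p))
    have e2 := integral_add i1 i2
    have e3 := integral_add i3 i4
    simp only [Pi.add_apply] at e1 e2 e3
    rw [e1, e2, integral_const_mul, integral_const_mul, horth, e3]
    ring
  rw [heq] at hle
  refine hle.trans ?_
  have hf0 : 0 ≤ ∫ ω, |f ω| ^ p ∂P := integral_nonneg fun ω => by positivity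
  have hg0 : 0 ≤ ∫ ω, |g ω| ^ p ∂P := integral_nonneg fun ω => by positivity
  have hbp : b ^ p = (b ^ 2) ^ (p / 2) := by
    rw [← Real.rpow_natCast b 2, ← Real.rpow_mul hb]; congr 1; push_cast; ring
  have hX : (∫ ω, |f ω| ^ p ∂P) ^ ((p - 2) / p) ≤ (burkholderConst p * S) ^ (p / 2 - 1) := by
    calc _ ≤ ((burkholderConst p * S) ^ (p / 2)) ^ ((p - 2) / p) :=
          Real.rpow_le_rpow hf0 hfS (div_nonneg (by linarith) hp0.le)
      _ = _ := by
        rw [← Real.rpow_mul (by positivity)]; congr 1; field_simp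
  have hY : (∫ ω, |g ω| ^ p ∂P) ^ (2 / p) ≤ b ^ 2 := by
    calc _ ≤ (b ^ p) ^ (2 / p) := Real.rpow_le_rpow hg0 hgb (by positivity)
      _ = _ := by
        rw [← Real.rpow_mul hb, mul_div_cancel₀ _ hp0.ne']; exact_mod_cast Real.rpow_natCast b 2
  have hstep := burkholder_step (q := p / 2) (A := burkholderConst p) (c := expansionConst p)
    (s := S) (b := b ^ 2) (by linarith) hc rfl hS (by positivity)
  refine le_trans ?_ hstep
  rw [← hbp]
  gcongr
  exact (integral_abs_rpow_mul_le hp hf hg).trans (by gcongr)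

lemma integral_abs_rpow_le_of_eLpNorm_le {p b : ℝ} (hp : 0 < p) (hb : 0 ≤ b) {f : Ω → ℝ}
    (hf : AEStronglyMeasurable f P) (h : eLpNorm f (ENNReal.ofReal p) P ≤ ENNReal.ofReal b) :
    ∫ ω, |f ω| ^ p ∂P ≤ b ^ p := by
  have hm : MemLp f (ENNReal.ofReal p) P := ⟨hf, h.trans_lt ENNReal.ofReal_lt_top⟩
  have e := hm.eLpNorm_eq_integral_rpow_norm (by simpa using hp) ENNReal.ofReal_ne_top
  rw [ENNReal.toReal_ofReal hp.le] at e
  rw [e, ENNReal.ofReal_le_ofReal_iff hb] at h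
  have hn : 0 ≤ ∫ ω, ‖f ω‖ ^ p ∂P := integral_nonneg fun ω => by positivity
  calc ∫ ω, |f ω| ^ p ∂P = ((∫ ω, ‖f ω‖ ^ p ∂P) ^ p⁻¹) ^ p := by
        rw [← Real.rpow_mul hn, inv_mul_cancel₀ hp.ne', Real.rpow_one]; rfl
    _ ≤ b ^ p := Real.rpow_le_rpow (by positivity) h hp.le

lemma eLpNorm_le_of_integral_abs_rpow_le {p b : ℝ} (hp : 0 < p) (hb : 0 ≤ b) {f : Ω → ℝ}
    (hm : MemLp f (ENNReal.ofReal p) P) (h : ∫ ω, |f ω| ^ p ∂P ≤ b ^ p) :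
    eLpNorm f (ENNReal.ofReal p) P ≤ ENNReal.ofReal b := by
  rw [hm.eLpNorm_eq_integral_rpow_norm (by simpa using hp) ENNReal.ofReal_ne_top,
    ENNReal.toReal_ofReal hp.le]
  refine ENNReal.ofReal_le_ofReal ?_
  have hn : 0 ≤ ∫ ω, ‖f ω‖ ^ p ∂P := integral_nonneg fun ω => by positivity
  calc (∫ ω, ‖f ω‖ ^ p ∂P) ^ p⁻¹ ≤ (b ^ p) ^ p⁻¹ := Real.rpow_le_rpow hn h (by positivity)
    _ = b := by rw [← Real.rpow_mul hb, mul_inv_cancel₀ hp.ne', Real.rpow_one]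

/-- A Burkholder-type inequality: if each `D t` is orthogonal to the odd power of every sum of
earlier terms, then `‖∑ D t‖_p ≤ √(A_p ∑ ‖D t‖_p²)`. -/
lemma eLpNorm_sum_le_of_integral_oddPow_eq_zero {ι : Type*} [LinearOrder ι] {p : ℝ} (hp : 2 < p)
    (I : Finset ι) (D : ι → Ω → ℝ) (b : ι → ℝ) (hD : ∀ t ∈ I, AEStronglyMeasurable (D t) P)
    (hb : ∀ t ∈ I, 0 ≤ b t)
    (hDb : ∀ t ∈ I, eLpNorm (D t) (ENNReal.ofReal p) P ≤ ENNReal.ofReal (b t))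
    (horth : ∀ t ∈ I, ∀ J ⊆ I, (∀ s ∈ J, s < t) →
      ∫ ω, oddPow p (∑ s ∈ J, D s ω) * D t ω ∂P = 0) :
    eLpNorm (fun ω => ∑ t ∈ I, D t ω) (ENNReal.ofReal p) P
      ≤ ENNReal.ofReal √(burkholderConst p * ∑ t ∈ I, b t ^ 2) := by
  have hp0 : 0 < p := by linarith
  have hA := (burkholderConst_pos hp).le
  have hmem : ∀ t ∈ I, MemLp (D t) (ENNReal.ofReal p) P := fun t ht =>
    ⟨hD t ht, (hDb t ht).trans_lt ENNReal.ofReal_lt_top⟩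
  have hsum : ∀ J ⊆ I, MemLp (fun ω => ∑ t ∈ J, D t ω) (ENNReal.ofReal p) P := fun J hJ =>
    memLp_finsetSum _ fun t ht => hmem t (hJ ht)
  have key : ∀ J : Finset ι, J ⊆ I →
      ∫ ω, |∑ t ∈ J, D t ω| ^ p ∂P ≤ (burkholderConst p * ∑ t ∈ J, b t ^ 2) ^ (p / 2) := by
    intro J
    induction J using Finset.induction_on_max with
    | empty => intro _; simp [Real.zero_rpow hp0.ne', Real.zero_rpow (by positivity : p / 2 ≠ 0)]
    | insert t J hlt ih =>
      intro hJ
      have htI : t ∈ I := hJ (Finset.mem_insert_self _ _)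
      have hJI : J ⊆ I := (Finset.subset_insert _ _).trans hJ
      have htJ : t ∉ J := fun h => lt_irrefl _ (hlt t h)
      have := integral_abs_add_rpow_le hp (hsum J hJI) (hmem t htI) (hb t htI)
        (Finset.sum_nonneg fun s _ => sq_nonneg (b s)) (ih hJI)
        (integral_abs_rpow_le_of_eLpNorm_le hp0 (hb t htI) (hD t htI) (hDb t htI))
        (horth t htI J hJI hlt)
      simpa [Finset.sum_insert htJ, add_comm] using this
  refine eLpNorm_le_of_integral_abs_rpow_le hp0 (Real.sqrt_nonneg _) (hsum I subset_rfl)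
    ((key I subset_rfl).trans_eq ?_)
  rw [Real.sqrt_eq_rpow, ← Real.rpow_mul (mul_nonneg hA
    (Finset.sum_nonneg fun s _ => sq_nonneg (b s)))]
  congr 1; ring

end Burkholder

/-! ### Moment bounds for real causal processes via martingale increments -/

section ScalarProcess

variable {E : Type*} [MeasurableSpace E] {ν : ℤ → Measure E} [∀ i, IsProbabilityMeasure (ν i)]

/-- A centred causal real process `h` on the space of innovation sequences, whose `L^p` dependence
on the innovation `j` steps in the past is at most `δ j`. -/
structure IsCausalProcess (ν : ℤ → Measure E) [∀ i, IsProbabilityMeasure (ν i)] (p : ℝ)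
    (δ : ℕ → ℝ≥0∞) (h : ℤ → (ℤ → E) → ℝ) : Prop where
  measurable : ∀ t, Measurable (h t)
  dependsOn : ∀ t, DependsOn (h t) (Set.Iic t)
  memLp : ∀ t, MemLp (h t) (ENNReal.ofReal p) (Measure.infinitePi ν)
  mean_zero : ∀ t, ∫ x, h t x ∂(Measure.infinitePi ν) = 0
  coupling_le : ∀ t (j : ℕ),
    eLpNorm (fun q : (ℤ → E) × (ℤ → E) => h t q.1 - h t (splice {t - (j : ℤ)}ᶜ q.1 q.2))
      (ENNReal.ofReal p) ((Measure.infinitePi ν).prod (Measure.infinitePi ν)) ≤ δ j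

/-- The window of the last `n` innovation times up to `s`. -/
def window (s : ℤ) (n : ℕ) : Set ℤ := Set.Ioc (s - n) s

lemma window_zero (s : ℤ) : window s 0 = ∅ := by simp [window]

lemma window_succ (s : ℤ) (n : ℕ) : window s (n + 1) = insert (s - (n : ℤ)) (window s n) := by
  ext i; simp only [window, Set.mem_Ioc, Set.mem_insert_iff]; push_cast; omega

lemma monotone_window (s : ℤ) : Monotone (window s) := fun m n h =>
  Set.Ioc_subset_Ioc_left (by have : (m : ℤ) ≤ n := by exact_mod_cast h
                              linarith)

lemma iUnion_window (s : ℤ) : ⋃ n, window s n = Set.Iic s := by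
  ext i
  simp only [window, Set.mem_iUnion, Set.mem_Ioc, Set.mem_Iic]
  exact ⟨fun ⟨_, h⟩ => h.2, fun h => ⟨(s - i + 1).toNat, by omega, h⟩⟩

lemma window_toNat_sub {t s : ℤ} (h : t ≤ s) : window s (s - t).toNat = Set.Ioc t s := by
  rw [window, Int.toNat_of_nonneg (by omega), sub_sub_cancel]

/-- The effect on the conditional expectation of `h s` of extending the window to the innovation
`j` steps in the past. -/
noncomputable def increment (ν : ℤ → Measure E) (h : ℤ → (ℤ → E) → ℝ) (s : ℤ) (j : ℕ)
    (x : ℤ → E) : ℝ :=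
  coordAvg ν (window s (j + 1)) (h s) x - coordAvg ν (window s j) (h s) x

variable {p : ℝ} {δ : ℕ → ℝ≥0∞} {h : ℤ → (ℤ → E) → ℝ}

lemma eLpNorm_le_of_tendsto_ae {Ω F : Type*} [MeasurableSpace Ω] [NormedAddCommGroup F]
    {P : Measure Ω} {f : ℕ → Ω → F} {f_lim : Ω → F} {p K : ℝ≥0∞}
    (hf : ∀ n, AEStronglyMeasurable (f n) P)
    (hlim : ∀ᵐ x ∂P, Tendsto (fun n => f n x) atTop (𝓝 (f_lim x)))
    (hK : ∀ᶠ n in atTop, eLpNorm (f n) p P ≤ K) : eLpNorm f_lim p P ≤ K :=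
  (Lp.eLpNorm_lim_le_liminf_eLpNorm hf f_lim hlim).trans
    (liminf_le_of_frequently_le' hK.frequently)

namespace IsCausalProcess

lemma integrable (H : IsCausalProcess ν p δ h) (hp : 1 ≤ p) (t : ℤ) :
    Integrable (h t) (Measure.infinitePi ν) :=
  (H.memLp t).integrable (by simpa using hp)

lemma stronglyMeasurable_increment (H : IsCausalProcess ν p δ h) (s : ℤ) (j : ℕ) :
    StronglyMeasurable (increment ν h s j) :=
  (stronglyMeasurable_coordAvg ν _ (H.measurable s).stronglyMeasurable).sub
    (stronglyMeasurable_coordAvg ν _ (H.measurable s).stronglyMeasurable)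

lemma eLpNorm_increment_le (H : IsCausalProcess ν p δ h) (hp : 1 ≤ p) (s : ℤ) (j : ℕ) :
    eLpNorm (increment ν h s j) (ENNReal.ofReal p) (Measure.infinitePi ν) ≤ δ j := by
  refine le_trans ?_ (H.coupling_le s j)
  have := eLpNorm_coordAvg_insert_sub_le (ν := ν) (S := window s j) (i := s - j)
    (by simp [window]) (H.measurable s).stronglyMeasurable (H.integrable hp s) hp
  rw [← window_succ] at this
  exact this

omit [∀ i, IsProbabilityMeasure (ν i)] in
lemma dependsOn_increment (s : ℤ) (j : ℕ) :
    DependsOn (increment ν h s j) (window s (j + 1)) := fun x y hxy => by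
  have h1 := dependsOn_coordAvg ν (window s (j + 1)) (h s) hxy
  have h2 := ((dependsOn_coordAvg ν (window s j) (h s)).mono
    (monotone_window s j.le_succ)) hxy
  rw [increment, increment, h1, h2]

omit [∀ i, IsProbabilityMeasure (ν i)] in
lemma sum_increment (s : ℤ) (m n : ℕ) (hmn : m ≤ n) (x : ℤ → E) :
    ∑ j ∈ Finset.Ico m n, increment ν h s j x
      = coordAvg ν (window s n) (h s) x - coordAvg ν (window s m) (h s) x :=
  Finset.sum_Ico_sub (fun j => coordAvg ν (window s j) (h s) x) hmn

lemma coordAvg_window_eq_sum (H : IsCausalProcess ν p δ h) (s : ℤ) (n : ℕ) (x : ℤ → E) :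
    coordAvg ν (window s n) (h s) x = ∑ j ∈ Finset.range n, increment ν h s j x := by
  rw [Finset.range_eq_Ico, sum_increment s 0 n (Nat.zero_le _), window_zero, coordAvg_empty,
    H.mean_zero, sub_zero]

/-- The two windows differ only in the coordinate `t - j`. Conditioning on strictly later times
removes it, so both averages become the same. -/
lemma coordAvg_increment (H : IsCausalProcess ν p δ h) (hp : 1 ≤ p) (t : ℤ) (j : ℕ) :
    coordAvg ν (Set.Ioi (t - (j : ℤ))) (increment ν h t j) =ᵐ[Measure.infinitePi ν] 0 := by
  have hi := H.integrable hp t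
  have e1 : Set.Ioi (t - (j : ℤ)) ∩ window t (j + 1) = window t j := by
    ext i; simp only [window, Set.mem_inter_iff, Set.mem_Ioi, Set.mem_Ioc]; push_cast; omega
  have e2 : Set.Ioi (t - (j : ℤ)) ∩ window t j = window t j := by
    ext i; simp only [window, Set.mem_inter_iff, Set.mem_Ioi, Set.mem_Ioc]; omega
  filter_upwards [coordAvg_sub (Set.Ioi (t - (j : ℤ))) (integrable_coordAvg (window t (j + 1)) hi)
      (integrable_coordAvg (window t j) hi),
    coordAvg_coordAvg (Set.Ioi (t - (j : ℤ))) (window t (j + 1)) hi,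
    coordAvg_coordAvg (Set.Ioi (t - (j : ℤ))) (window t j) hi] with x h1 h2 h3
  rw [e1] at h2
  rw [e2] at h3
  have h4 := h1.trans (by rw [h2, h3, sub_self])
  exact h4

/-- The increments at a fixed lag are martingale differences in reversed time. -/
lemma eLpNorm_sum_increment_le (H : IsCausalProcess ν p δ h) (hp : 2 < p) (I : Finset ℤ)
    (w : ℤ → ℝ) (j : ℕ) (hδ : δ j ≠ ⊤) :
    eLpNorm (fun x => ∑ s ∈ I, w s * increment ν h s j x) (ENNReal.ofReal p)
      (Measure.infinitePi ν)
      ≤ ENNReal.ofReal √(burkholderConst p * ∑ s ∈ I, w s ^ 2) * δ j := by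
  have hmeas : ∀ s, StronglyMeasurable fun x => w s * increment ν h s j x := fun s =>
    (H.stronglyMeasurable_increment s j).const_mul _
  have hbd : ∀ s, eLpNorm (fun x => w s * increment ν h s j x) (ENNReal.ofReal p)
      (Measure.infinitePi ν) ≤ ENNReal.ofReal (|w s| * (δ j).toReal) := fun s => by
    rw [ENNReal.ofReal_mul (abs_nonneg _), ENNReal.ofReal_toReal hδ]
    refine (eLpNorm_const_smul_le (c := w s) (f := increment ν h s j)).trans ?_
    rw [Real.enorm_eq_ofReal_abs]
    gcongr
    exact H.eLpNorm_increment_le (by linarith) s j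
  have hmem : ∀ s, MemLp (fun x => w s * increment ν h s j x) (ENNReal.ofReal p)
      (Measure.infinitePi ν) := fun s =>
    ⟨(hmeas s).aestronglyMeasurable, (hbd s).trans_lt ENNReal.ofReal_lt_top⟩
  -- Time is reversed: for `s > t` the lag-`j` increment at `s` involves only coordinates `≥ s - j >
  -- t - j`, and given those coordinates the increment at `t` has mean zero.
  have key := eLpNorm_sum_le_of_integral_oddPow_eq_zero (ι := ℤᵒᵈ) (P := Measure.infinitePi ν) hp
    (I.map OrderDual.toDual.toEmbedding)
    (fun s x => w (OrderDual.ofDual s) * increment ν h (OrderDual.ofDual s) j x)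
    (fun s => |w (OrderDual.ofDual s)| * (δ j).toReal)
    (fun s _ => (hmeas _).aestronglyMeasurable) (fun s _ => by positivity) (fun s _ => hbd _) ?_
  · simp only [Finset.sum_map, Equiv.coe_toEmbedding, OrderDual.ofDual_toDual, mul_pow, sq_abs,
      ← Finset.sum_mul] at key
    refine key.trans_eq ?_
    rw [← mul_assoc, Real.sqrt_mul (mul_nonneg (burkholderConst_pos hp).le
      (Finset.sum_nonneg fun _ _ => sq_nonneg _)), Real.sqrt_sq ENNReal.toReal_nonneg,
      ENNReal.ofReal_mul (Real.sqrt_nonneg _), ENNReal.ofReal_toReal hδ]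
  · intro t _ J _ hJ
    obtain ⟨t, rfl⟩ := OrderDual.toDual.surjective t
    simp only [OrderDual.ofDual_toDual]
    have hdep : DependsOn (fun x => oddPow p (∑ s ∈ J, w (OrderDual.ofDual s)
        * increment ν h (OrderDual.ofDual s) j x)) (Set.Ioi (t - (j : ℤ))) := by
      intro x y hxy
      dsimp only
      congr 1
      refine Finset.sum_congr rfl fun s hs => ?_
      have hlt : t < OrderDual.ofDual s := hJ s hs
      rw [dependsOn_increment (ν := ν) (h := h) (OrderDual.ofDual s) j fun i hi => hxy i ?_]
      simp only [window, Set.mem_Ioc, Set.mem_Ioi] at hi ⊢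
      push_cast at hi
      omega
    have hint := integrable_oddPow_mul (P := Measure.infinitePi ν) hp
      (memLp_finsetSum J fun s _ => hmem (OrderDual.ofDual s))
      (f := fun x => ∑ s ∈ J, w (OrderDual.ofDual s) * increment ν h (OrderDual.ofDual s) j x)
      ⟨(H.stronglyMeasurable_increment t j).aestronglyMeasurable,
        (H.eLpNorm_increment_le (by linarith) t j).trans_lt hδ.lt_top⟩
    have h0 := integral_mul_coordAvg (ν := ν) hdep hint
    rw [integral_eq_zero_of_ae (f := fun x => _ * coordAvg ν _ _ x) (by
      filter_upwards [H.coordAvg_increment (by linarith) t j] with x hx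
      rw [hx, Pi.zero_apply, mul_zero])] at h0
    have : ∀ x, oddPow p (∑ s ∈ J, w (OrderDual.ofDual s)
        * increment ν h (OrderDual.ofDual s) j x) * (w t * increment ν h t j x)
        = w t * (oddPow p (∑ s ∈ J, w (OrderDual.ofDual s)
        * increment ν h (OrderDual.ofDual s) j x) * increment ν h t j x) := fun x => by ring
    simp_rw [this]
    rw [integral_const_mul, h0, mul_zero]

/-- Summing lag by lag, a window of length `N s` merely sets the weight of `s` to zero at lags `j ≥
N s`, which can only decrease the `ℓ²` norm. Lengths varying with `s` are needed for `forwardAvg`.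
-/
lemma eLpNorm_sum_coordAvg_le (H : IsCausalProcess ν p δ h) (hp : 2 < p) (I : Finset ℤ)
    (w : ℤ → ℝ) (N : ℤ → ℕ) (hδ : ∑' j, δ j ≠ ⊤) :
    eLpNorm (fun x => ∑ s ∈ I, w s * coordAvg ν (window s (N s)) (h s) x) (ENNReal.ofReal p)
      (Measure.infinitePi ν)
      ≤ ENNReal.ofReal √(burkholderConst p * ∑ s ∈ I, w s ^ 2) * ∑' j, δ j := by
  have hδj : ∀ j, δ j ≠ ⊤ := ENNReal.ne_top_of_tsum_ne_top hδ
  set n := I.sup N with hn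
  have hsum : (fun x => ∑ s ∈ I, w s * coordAvg ν (window s (N s)) (h s) x)
      = ∑ j ∈ Finset.range n, fun x => ∑ s ∈ I,
        (if j < N s then w s else 0) * increment ν h s j x := by
    ext x
    rw [Finset.sum_apply, Finset.sum_comm]
    refine Finset.sum_congr rfl fun s hs => ?_
    rw [H.coordAvg_window_eq_sum, Finset.mul_sum]
    simp only [ite_mul, zero_mul]
    rw [← Finset.sum_filter]
    refine Finset.sum_congr ?_ fun _ _ => rfl
    ext j
    have : N s ≤ n := Finset.le_sup hs
    simp only [Finset.mem_range, Finset.mem_filter]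
    omega
  rw [hsum]
  refine (eLpNorm_sum_le (fun j _ => (Finset.stronglyMeasurable_fun_sum I fun s _ =>
    (H.stronglyMeasurable_increment s j).const_mul _).aestronglyMeasurable)
    (by simp; linarith)).trans ?_
  calc _ ≤ ∑ j ∈ Finset.range n,
        ENNReal.ofReal √(burkholderConst p * ∑ s ∈ I, w s ^ 2) * δ j := by
        refine Finset.sum_le_sum fun j _ => (H.eLpNorm_sum_increment_le hp I _ j (hδj j)).trans ?_
        have := (burkholderConst_pos hp).le
        gcongr ENNReal.ofReal √(_ * ?_) * _
        refine Finset.sum_le_sum fun s _ => ?_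
        split_ifs
        · exact le_rfl
        · simpa using sq_nonneg (w s)
    _ = ENNReal.ofReal √(burkholderConst p * ∑ s ∈ I, w s ^ 2) * ∑ j ∈ Finset.range n, δ j :=
        (Finset.mul_sum _ _ _).symm
    _ ≤ _ := by gcongr; exact ENNReal.sum_le_tsum _

lemma tendsto_coordAvg_window (H : IsCausalProcess ν p δ h) (hp : 1 ≤ p) (s : ℤ) :
    ∀ᵐ x ∂(Measure.infinitePi ν),
      Tendsto (fun n => coordAvg ν (window s n) (h s) x) atTop (𝓝 (h s x)) :=
  tendsto_coordAvg (monotone_window s) (H.measurable s) (H.integrable hp s)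
    (by rw [iUnion_window]; exact H.dependsOn s)

/-- The windows grow to the whole past; Lévy's theorem gives almost sure convergence and Fatou
carries the uniform bound to the limit. -/
lemma eLpNorm_sum_le (H : IsCausalProcess ν p δ h) (hp : 2 < p) (I : Finset ℤ)
    (w : ℤ → ℝ) (hδ : ∑' j, δ j ≠ ⊤) :
    eLpNorm (fun x => ∑ s ∈ I, w s * h s x) (ENNReal.ofReal p) (Measure.infinitePi ν)
      ≤ ENNReal.ofReal √(burkholderConst p * ∑ s ∈ I, w s ^ 2) * ∑' j, δ j := by
  refine eLpNorm_le_of_tendsto_ae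
    (f := fun n x => ∑ s ∈ I, w s * coordAvg ν (window s n) (h s) x) (fun n => ?_) ?_
    (Eventually.of_forall fun n => H.eLpNorm_sum_coordAvg_le hp I w (fun _ => n) hδ)
  · exact (Finset.stronglyMeasurable_fun_sum I fun s _ =>
      (stronglyMeasurable_coordAvg ν _ (H.measurable s).stronglyMeasurable).const_mul
        _).aestronglyMeasurable
  · filter_upwards [ae_all_iff.2 fun s => H.tendsto_coordAvg_window (by linarith) s] with x hx
    exact tendsto_finsetSum _ fun s _ => (hx s).const_mul _

lemma eLpNorm_sub_coordAvg_le (H : IsCausalProcess ν p δ h) (hp : 1 ≤ p) (s : ℤ) (m : ℕ) :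
    eLpNorm (fun x => h s x - coordAvg ν (window s m) (h s) x) (ENNReal.ofReal p)
      (Measure.infinitePi ν) ≤ ∑' j, δ (m + j) := by
  have hmeas : ∀ n, StronglyMeasurable (coordAvg ν (window s n) (h s)) := fun n =>
    stronglyMeasurable_coordAvg ν _ (H.measurable s).stronglyMeasurable
  refine eLpNorm_le_of_tendsto_ae
    (f := fun n x => coordAvg ν (window s n) (h s) x - coordAvg ν (window s m) (h s) x)
    (fun n => ((hmeas n).sub (hmeas m)).aestronglyMeasurable) ?_ ?_
  · filter_upwards [H.tendsto_coordAvg_window hp s] with x hx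
    exact hx.sub_const _
  · filter_upwards [eventually_ge_atTop m] with n hn
    have : (fun x => coordAvg ν (window s n) (h s) x - coordAvg ν (window s m) (h s) x)
        = ∑ j ∈ Finset.Ico m n, increment ν h s j := by
      ext x; rw [Finset.sum_apply, sum_increment s m n hn]
    rw [this]
    calc _ ≤ ∑ j ∈ Finset.Ico m n, eLpNorm (increment ν h s j) (ENNReal.ofReal p)
          (Measure.infinitePi ν) := MeasureTheory.eLpNorm_sum_le
            (fun j _ => (H.stronglyMeasurable_increment s j).aestronglyMeasurable) (by simpa using hp)
      _ ≤ ∑ j ∈ Finset.Ico m n, δ j := Finset.sum_le_sum fun j _ => H.eLpNorm_increment_le hp s j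
      _ = ∑ j ∈ Finset.range (n - m), δ (m + j) := Finset.sum_Ico_eq_sum_range _ _ _
      _ ≤ _ := ENNReal.sum_le_tsum _

end IsCausalProcess

end ScalarProcess

/-! ### From projections to vector norms -/

section VectorNorms

variable {Ω : Type*} [MeasurableSpace Ω] {P : Measure Ω} {d : ℕ}

/-- Bounds on all one-dimensional projections bound the norm of the vector. -/
lemma eLpNorm_le_of_inner {F : Ω → EuclideanSpace ℝ (Fin d)} (hF : AEStronglyMeasurable F P)
    {p : ℝ} (hp : 2 ≤ p) {K : ℝ≥0∞}
    (hK : ∀ a : EuclideanSpace ℝ (Fin d), ‖a‖ = 1 →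
      eLpNorm (fun ω => ⟪a, F ω⟫) (ENNReal.ofReal p) P ≤ K) :
    eLpNorm F (ENNReal.ofReal p) P ≤ ENNReal.ofReal √d * K := by
  have hpp : ENNReal.ofReal (p / 2) * ENNReal.ofReal 2 = ENNReal.ofReal p := by
    rw [← ENNReal.ofReal_mul (by linarith)]; congr 1; ring
  have hcoord : ∀ i, eLpNorm (fun ω => F ω i) (ENNReal.ofReal p) P ≤ K := fun i => by
    have := hK (EuclideanSpace.single i 1) (by simp)
    simpa [EuclideanSpace.inner_single_left] using this
  have hmeas : ∀ i, AEStronglyMeasurable (fun ω => F ω i) P := fun i =>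
    (EuclideanSpace.proj (𝕜 := ℝ) i).continuous.comp_aestronglyMeasurable hF
  have hsum : (fun ω => ‖F ω‖ ^ (2 : ℝ)) = ∑ i, fun ω => ‖F ω i‖ ^ (2 : ℝ) := by
    ext ω
    rw [Finset.sum_apply]
    simp only [Real.rpow_two]
    exact EuclideanSpace.norm_sq_eq _
  -- Minkowski in `L^{p/2}` for the squared coordinates: `d` terms of size `K²`, hence the factor
  -- `√d`.
  have h2 : eLpNorm F (ENNReal.ofReal p) P ^ (2 : ℝ) ≤ (ENNReal.ofReal √d * K) ^ (2 : ℝ) := by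
    rw [← hpp, ← eLpNorm_norm_rpow F (by norm_num), hsum]
    calc _ ≤ ∑ i, eLpNorm (fun ω => ‖F ω i‖ ^ (2 : ℝ)) (ENNReal.ofReal (p / 2)) P :=
          eLpNorm_sum_le (fun i _ => ((hmeas i).norm.aemeasurable.pow_const _).aestronglyMeasurable)
            (by simp; linarith)
      _ = ∑ i, eLpNorm (fun ω => F ω i) (ENNReal.ofReal p) P ^ (2 : ℝ) := by
          simp_rw [eLpNorm_norm_rpow _ (zero_lt_two' ℝ), hpp]
      _ ≤ ∑ _i : Fin d, K ^ (2 : ℝ) := by gcongr; exact hcoord _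
      _ = _ := by
          rw [ENNReal.mul_rpow_of_nonneg _ _ zero_le_two, Finset.sum_const, Finset.card_univ,
            Fintype.card_fin, nsmul_eq_mul, ENNReal.ofReal_rpow_of_nonneg (Real.sqrt_nonneg _)
            zero_le_two, Real.rpow_two, Real.sq_sqrt (Nat.cast_nonneg d), ENNReal.ofReal_natCast]
  exact (ENNReal.rpow_le_rpow_iff zero_lt_two).1 h2

lemma eLpNorm_inner_const_le {F : Ω → EuclideanSpace ℝ (Fin d)} {p K : ℝ≥0∞}
    (hK : ∀ a : EuclideanSpace ℝ (Fin d), ‖a‖ = 1 → eLpNorm (fun ω => ⟪a, F ω⟫) p P ≤ K)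
    (a : EuclideanSpace ℝ (Fin d)) :
    eLpNorm (fun ω => ⟪a, F ω⟫) p P ≤ ENNReal.ofReal ‖a‖ * K := by
  rcases eq_or_ne a 0 with rfl | ha
  · simp
  have h : (fun ω => ⟪a, F ω⟫) = ‖a‖ • fun ω => ⟪‖a‖⁻¹ • a, F ω⟫ := by
    ext ω
    rw [Pi.smul_apply, real_inner_smul_left, smul_eq_mul, mul_inv_cancel_left₀ (norm_ne_zero_iff.2 ha)]
  rw [h]
  refine eLpNorm_const_smul_le.trans ?_
  rw [Real.enorm_eq_ofReal_abs, abs_norm]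
  gcongr
  exact hK _ (norm_smul_inv_norm (𝕜 := ℝ) ha)

/-- Hölder's inequality for the inner product. -/
lemma eLpNorm_inner_le_mul {F G : Ω → EuclideanSpace ℝ (Fin d)} (hF : AEStronglyMeasurable F P)
    (hG : AEStronglyMeasurable G P) {p : ℝ} (hp : 0 < p) :
    eLpNorm (fun ω => ⟪F ω, G ω⟫) (ENNReal.ofReal (p / 2)) P
      ≤ eLpNorm F (ENNReal.ofReal p) P * eLpNorm G (ENNReal.ofReal p) P := by
  have hT : ENNReal.HolderTriple (ENNReal.ofReal p) (ENNReal.ofReal p)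
      (ENNReal.ofReal (p / 2)) := by
    constructor
    rw [← ENNReal.ofReal_inv_of_pos hp, ← ENNReal.ofReal_inv_of_pos (by positivity),
      ← ENNReal.ofReal_add (by positivity) (by positivity)]
    congr 1; field_simp; norm_num
  have := eLpNorm_le_eLpNorm_mul_eLpNorm_of_nnnorm hF hG (fun x y => ⟪x, y⟫) 1
    (Eventually.of_forall fun ω => by
      rw [one_mul]; exact_mod_cast norm_inner_le_norm (𝕜 := ℝ) (F ω) (G ω))
    (p := ENNReal.ofReal p) (q := ENNReal.ofReal p) (r := ENNReal.ofReal (p / 2))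
  simpa using this

end VectorNorms

/-! ### Inner products of independent vectors -/

section Independence

variable {ι E : Type*} [MeasurableSpace E] {ν : ι → Measure E} [∀ i, IsProbabilityMeasure (ν i)]
  {d : ℕ}

/-- The inner product of vectors depending on disjoint sets of coordinates. -/
lemma eLpNorm_inner_le_of_dependsOn {F G : (ι → E) → EuclideanSpace ℝ (Fin d)} {S : Set ι}
    (hF : StronglyMeasurable F) (hG : StronglyMeasurable G) (hFS : DependsOn F S)
    (hGS : DependsOn G Sᶜ) {q : ℝ} (hq : 0 < q) {K : ℝ≥0∞}
    (hK : ∀ a : EuclideanSpace ℝ (Fin d), ‖a‖ = 1 →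
      eLpNorm (fun x => ⟪a, G x⟫) (ENNReal.ofReal q) (Measure.infinitePi ν) ≤ K) :
    eLpNorm (fun x => ⟪F x, G x⟫) (ENNReal.ofReal q) (Measure.infinitePi ν)
      ≤ eLpNorm F (ENNReal.ofReal q) (Measure.infinitePi ν) * K := by
  have hq1 : ENNReal.ofReal q ≠ 0 := by simpa using hq
  have hFG : StronglyMeasurable fun x => ⟪F x, G x⟫ := hF.inner hG
  -- Splicing turns the pair into functions of two independent configurations. With the first
  -- frozen, `G` is projected on the fixed vector `F x`; only `F` contributes a factor `√d`, whereas
  -- Hölder would charge it for both vectors.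
  rw [← eLpNorm_comp_measurePreserving hFG.aestronglyMeasurable (measurePreserving_splice ν S)]
  have e : (fun x => ⟪F x, G x⟫) ∘ (fun p : (ι → E) × (ι → E) => splice S p.1 p.2)
      = fun p => ⟪F p.1, G p.2⟫ := by
    ext p
    simp only [Function.comp]
    rw [hFS.splice_left, hGS.splice_right disjoint_compl_right]
  have hm : StronglyMeasurable fun p : (ι → E) × (ι → E) => ⟪F p.1, G p.2⟫ :=
    (hF.comp_measurable measurable_fst).inner (hG.comp_measurable measurable_snd)
  rw [e]
  rw [← ENNReal.rpow_le_rpow_iff hq, ENNReal.mul_rpow_of_nonneg _ _ hq.le]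
  have hpow : ∀ {α : Type _} {V : Type} [MeasurableSpace α] [NormedAddCommGroup V]
      (Q : Measure α) (f : α → V),
      eLpNorm f (ENNReal.ofReal q) Q ^ q = ∫⁻ x, ‖f x‖ₑ ^ q ∂Q := by
    intro α V _ _ Q f
    rw [eLpNorm_eq_lintegral_rpow_enorm_toReal hq1 ENNReal.ofReal_ne_top,
      ENNReal.toReal_ofReal hq.le, ← ENNReal.rpow_mul]
    simp [hq.ne']
  rw [hpow, hpow, lintegral_prod _ (by fun_prop), ← lintegral_mul_const _ (by fun_prop)]
  refine lintegral_mono fun x => ?_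
  have := ENNReal.rpow_le_rpow (eLpNorm_inner_const_le hK (F x)) hq.le
  rw [hpow, ENNReal.mul_rpow_of_nonneg _ _ hq.le, ofReal_norm] at this
  exact this

/-- Given the coordinates in `S`, both `u` and `F` are constants and `G` is independent with mean
zero. This supplies the orthogonality required by the Burkholder inequality. -/
lemma integral_mul_inner_eq_zero {u : (ι → E) → ℝ} {F G : (ι → E) → EuclideanSpace ℝ (Fin d)}
    {S : Set ι} (hu : DependsOn u S) (hFS : DependsOn F S) (hGS : DependsOn G Sᶜ)
    (hG : Integrable G (Measure.infinitePi ν)) (hG0 : ∫ x, G x ∂(Measure.infinitePi ν) = 0)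
    (hint : Integrable (fun x => u x * ⟪F x, G x⟫) (Measure.infinitePi ν)) :
    ∫ x, u x * ⟪F x, G x⟫ ∂(Measure.infinitePi ν) = 0 := by
  rw [integral_mul_coordAvg hu hint]
  have : ∀ x, coordAvg ν S (fun x => ⟪F x, G x⟫) x = 0 := fun x => by
    simp only [coordAvg, hFS.splice_left, hGS.splice_right disjoint_compl_right]
    rw [integral_inner hG, hG0, inner_zero_right]
  simp [this]

end Independence

/-! ### Vector processes and decoupled forward sums -/

section VectorProcess

variable {E : Type*} [MeasurableSpace E] {ν : ℤ → Measure E} [∀ i, IsProbabilityMeasure (ν i)]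
  {d : ℕ}

/-- A centred causal vector process on the space of innovation sequences whose one-dimensional
projections have `L^p` norm at most `C` and dependence coefficients at most `δ`. -/
structure IsCausalVectorProcess (ν : ℤ → Measure E) [∀ i, IsProbabilityMeasure (ν i)] (p C : ℝ)
    (δ : ℕ → ℝ≥0∞) (f : ℤ → (ℤ → E) → EuclideanSpace ℝ (Fin d)) : Prop where
  nonneg : 0 ≤ C
  measurable : ∀ t, Measurable (f t)
  dependsOn : ∀ t, DependsOn (f t) (Set.Iic t)
  mean_zero : ∀ t, ∫ x, f t x ∂(Measure.infinitePi ν) = 0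
  moment_le : ∀ t (a : EuclideanSpace ℝ (Fin d)), ‖a‖ = 1 →
    eLpNorm (fun x => ⟪a, f t x⟫) (ENNReal.ofReal p) (Measure.infinitePi ν) ≤ ENNReal.ofReal C
  coupling_le : ∀ t (a : EuclideanSpace ℝ (Fin d)), ‖a‖ = 1 → ∀ j : ℕ,
    eLpNorm (fun q : (ℤ → E) × (ℤ → E) =>
        ⟪a, f t q.1 - f t (splice {t - (j : ℤ)}ᶜ q.1 q.2)⟫)
      (ENNReal.ofReal p) ((Measure.infinitePi ν).prod (Measure.infinitePi ν)) ≤ δ j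
  tsum_le : ∑' j, δ j ≤ ENNReal.ofReal C

/-- The times in `{1, …, T}` that follow `t` with a lag between `B` and `B₁`. -/
noncomputable def forwardWindow (T B B₁ : ℕ) (t : ℤ) : Finset ℤ := Finset.Icc (t + B) (min (t + B₁) T)

lemma card_forwardWindow_le (T B B₁ : ℕ) (t : ℤ) :
    (forwardWindow T B B₁ t).card ≤ B₁ + 1 - B := by
  rw [forwardWindow, Int.card_Icc]; omega

/-- The sum of the values of `f` over the forward window of `t`, with the innovations up to time
`t` averaged out. -/
noncomputable def forwardAvg (ν : ℤ → Measure E) (T B B₁ : ℕ)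
    (f : ℤ → (ℤ → E) → EuclideanSpace ℝ (Fin d)) (t : ℤ) (x : ℤ → E) :
    EuclideanSpace ℝ (Fin d) :=
  ∑ s ∈ forwardWindow T B B₁ t, coordAvg ν (window s (s - t).toNat) (f s) x

variable {p C : ℝ} {δ : ℕ → ℝ≥0∞} {f : ℤ → (ℤ → E) → EuclideanSpace ℝ (Fin d)}

namespace IsCausalVectorProcess

lemma eLpNorm_le (H : IsCausalVectorProcess ν p C δ f) (hp : 2 ≤ p) (t : ℤ) :
    eLpNorm (f t) (ENNReal.ofReal p) (Measure.infinitePi ν) ≤ ENNReal.ofReal (√d * C) := by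
  rw [ENNReal.ofReal_mul (Real.sqrt_nonneg _)]
  exact eLpNorm_le_of_inner (H.measurable t).aestronglyMeasurable hp (H.moment_le t)

lemma memLp (H : IsCausalVectorProcess ν p C δ f) (hp : 2 ≤ p) (t : ℤ) :
    MemLp (f t) (ENNReal.ofReal p) (Measure.infinitePi ν) :=
  ⟨(H.measurable t).aestronglyMeasurable, (H.eLpNorm_le hp t).trans_lt ENNReal.ofReal_lt_top⟩

lemma integrable (H : IsCausalVectorProcess ν p C δ f) (hp : 2 ≤ p) (t : ℤ) :
    Integrable (f t) (Measure.infinitePi ν) :=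
  (H.memLp hp t).integrable (by simp; linarith)

lemma tsum_ne_top (H : IsCausalVectorProcess ν p C δ f) : ∑' j, δ j ≠ ⊤ :=
  (H.tsum_le.trans_lt ENNReal.ofReal_lt_top).ne

lemma inner (H : IsCausalVectorProcess ν p C δ f) (hp : 2 ≤ p) {a : EuclideanSpace ℝ (Fin d)}
    (ha : ‖a‖ = 1) : IsCausalProcess ν p δ fun t x => ⟪a, f t x⟫ where
  measurable t := (H.measurable t).const_inner
  dependsOn t x y hxy := by simp only; rw [H.dependsOn t hxy]
  memLp t := (H.memLp hp t).const_inner a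
  mean_zero t := by rw [integral_inner (H.integrable hp t), H.mean_zero, inner_zero_right]
  coupling_le t j := by simpa only [inner_sub_right] using H.coupling_le t a ha j

/-- Weighted sums of the process: the projections are of the order of the `ℓ²` norm of the
weights. -/
lemma eLpNorm_inner_sum_le (H : IsCausalVectorProcess ν p C δ f) (hp : 2 < p) (I : Finset ℤ)
    (w : ℤ → ℝ) (a : EuclideanSpace ℝ (Fin d)) :
    eLpNorm (fun x => ⟪a, ∑ s ∈ I, w s • f s x⟫) (ENNReal.ofReal p) (Measure.infinitePi ν)
      ≤ ENNReal.ofReal (‖a‖ * (√(burkholderConst p * ∑ s ∈ I, w s ^ 2) * C)) := by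
  rw [ENNReal.ofReal_mul (norm_nonneg _)]
  refine eLpNorm_inner_const_le (fun a ha => ?_) a
  have := (H.inner hp.le ha).eLpNorm_sum_le hp I w H.tsum_ne_top
  rw [ENNReal.ofReal_mul (Real.sqrt_nonneg _)]
  simp only [inner_sum, real_inner_smul_right]
  exact this.trans (by gcongr; exact H.tsum_le)

lemma coordAvg_inner_ae (H : IsCausalVectorProcess ν p C δ f) (hp : 2 ≤ p)
    (a : EuclideanSpace ℝ (Fin d)) (S : ℤ → Set ℤ) :
    ∀ᵐ x ∂(Measure.infinitePi ν), ∀ s,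
      coordAvg ν (S s) (fun x => ⟪a, f s x⟫) x = ⟪a, coordAvg ν (S s) (f s) x⟫ :=
  ae_all_iff.2 fun s => coordAvg_inner (S s) (H.integrable hp s) a

lemma stronglyMeasurable_forwardAvg (H : IsCausalVectorProcess ν p C δ f) (T B B₁ : ℕ) (t : ℤ) :
    StronglyMeasurable (forwardAvg ν T B B₁ f t) :=
  Finset.stronglyMeasurable_fun_sum _ fun s _ =>
    stronglyMeasurable_coordAvg ν _ (H.measurable s).stronglyMeasurable

lemma eLpNorm_inner_forwardAvg_le (H : IsCausalVectorProcess ν p C δ f) (hp : 2 < p)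
    (T B B₁ : ℕ) (t : ℤ) {a : EuclideanSpace ℝ (Fin d)} (ha : ‖a‖ = 1) :
    eLpNorm (fun x => ⟪a, forwardAvg ν T B B₁ f t x⟫) (ENNReal.ofReal p) (Measure.infinitePi ν)
      ≤ ENNReal.ofReal (√(burkholderConst p * (B₁ + 1 - B : ℕ)) * C) := by
  have h := (H.inner hp.le ha).eLpNorm_sum_coordAvg_le hp (forwardWindow T B B₁ t) (fun _ => 1)
    (fun s => (s - t).toNat) H.tsum_ne_top
  have e : (fun x => ⟪a, forwardAvg ν T B B₁ f t x⟫) =ᵐ[Measure.infinitePi ν]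
      fun x => ∑ s ∈ forwardWindow T B B₁ t,
        1 * coordAvg ν (window s (s - t).toNat) (fun x => ⟪a, f s x⟫) x := by
    filter_upwards [H.coordAvg_inner_ae hp.le a fun s => window s (s - t).toNat] with x hx
    simp only [forwardAvg, inner_sum, hx, one_mul]
  rw [eLpNorm_congr_ae e, ENNReal.ofReal_mul (Real.sqrt_nonneg _)]
  refine h.trans ?_
  have := (burkholderConst_pos hp).le
  gcongr
  · simpa using card_forwardWindow_le T B B₁ t
  · exact H.tsum_le

lemma integrable_forwardAvg (H : IsCausalVectorProcess ν p C δ f) (hp : 2 ≤ p)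
    (T B B₁ : ℕ) (t : ℤ) : Integrable (forwardAvg ν T B B₁ f t) (Measure.infinitePi ν) :=
  integrable_finsetSum _ fun s _ => integrable_coordAvg _ (H.integrable hp s)

lemma integral_forwardAvg (H : IsCausalVectorProcess ν p C δ f) (hp : 2 ≤ p)
    (T B B₁ : ℕ) (t : ℤ) : ∫ x, forwardAvg ν T B B₁ f t x ∂(Measure.infinitePi ν) = 0 := by
  simp only [forwardAvg]
  rw [integral_finsetSum _ fun s _ => integrable_coordAvg _ (H.integrable hp s)]
  exact Finset.sum_eq_zero fun s _ => by
    rw [integral_coordAvg _ (H.integrable hp s), H.mean_zero]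

omit [∀ i, IsProbabilityMeasure (ν i)] in
lemma dependsOn_forwardAvg (T B B₁ : ℕ) (t : ℤ) :
    DependsOn (forwardAvg ν T B B₁ f t) (Set.Ioc t (t + B₁)) := by
  intro x y hxy
  refine Finset.sum_congr rfl fun s hs => ?_
  refine dependsOn_coordAvg ν _ _ fun i hi => hxy i ?_
  simp only [forwardWindow, Finset.mem_Icc, le_min_iff] at hs
  rw [window_toNat_sub (by omega)] at hi
  exact ⟨hi.1, hi.2.trans hs.2.1⟩

/-- The size of the products `⟪f t, forwardAvg t⟫`. -/
lemma eLpNorm_inner_forwardAvg_self_le (H : IsCausalVectorProcess ν p C δ f) (hp : 4 < p)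
    (T B B₁ : ℕ) (t : ℤ) :
    eLpNorm (fun x => ⟪f t x, forwardAvg ν T B B₁ f t x⟫) (ENNReal.ofReal (p / 2))
      (Measure.infinitePi ν)
      ≤ ENNReal.ofReal (√d * C * (√(burkholderConst p * (B₁ + 1 - B : ℕ)) * C)) := by
  have hle : ENNReal.ofReal (p / 2) ≤ ENNReal.ofReal p := ENNReal.ofReal_le_ofReal (by linarith)
  have hG := H.stronglyMeasurable_forwardAvg T B B₁ t
  have hC := H.nonneg
  rw [ENNReal.ofReal_mul (by positivity)]
  refine (eLpNorm_inner_le_of_dependsOn (S := Set.Iic t) (H.measurable t).stronglyMeasurable hG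
    (H.dependsOn t) ((dependsOn_forwardAvg T B B₁ t).mono fun i hi => by simpa using hi.1)
    (by linarith) (fun a ha => (eLpNorm_le_eLpNorm_of_exponent_le hle
      ((stronglyMeasurable_const (b := a)).inner hG).aestronglyMeasurable).trans
        (H.eLpNorm_inner_forwardAvg_le (by linarith) T B B₁ t ha))).trans ?_
  gcongr
  exact (eLpNorm_le_eLpNorm_of_exponent_le hle (H.measurable t).aestronglyMeasurable).trans
    (H.eLpNorm_le (by linarith) t)

end IsCausalVectorProcess

end VectorProcess

/-! ### The one-sided lagged quadratic form -/

section QuadraticForm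

variable {E : Type*} [MeasurableSpace E] {ν : ℤ → Measure E} [∀ i, IsProbabilityMeasure (ν i)]
  {d : ℕ} {p C : ℝ} {δ : ℕ → ℝ≥0∞} {f : ℤ → (ℤ → E) → EuclideanSpace ℝ (Fin d)}

/-- Cauchy–Schwarz over the `B₁` residue classes, whose sizes add up to `T`. It combines the
square-root bounds of the separate classes. -/
lemma sum_sqrt_card_emod_le (T B₁ : ℕ) (hB₁ : 0 < B₁) :
    ∑ r ∈ Finset.Ico (0 : ℤ) B₁, √(((Finset.Icc (1 : ℤ) T).filter (· % (B₁ : ℤ) = r)).card : ℝ)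
      ≤ √(B₁ * T) := by
  refine Real.le_sqrt_of_sq_le (sq_sum_le_card_mul_sum_sq.trans_eq ?_)
  have h : ∀ r : ℤ, √(((Finset.Icc (1 : ℤ) T).filter (· % (B₁ : ℤ) = r)).card : ℝ) ^ 2
      = (((Finset.Icc (1 : ℤ) T).filter (· % (B₁ : ℤ) = r)).card : ℝ) := fun r =>
    Real.sq_sqrt (Nat.cast_nonneg _)
  simp_rw [h]
  rw [← Nat.cast_sum, ← Finset.card_eq_sum_card_fiberwise (f := fun t : ℤ => t % (B₁ : ℤ))]
  · simp
  · intro t _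
    have : (0 : ℤ) < B₁ := by exact_mod_cast hB₁
    simpa using ⟨Int.emod_nonneg t this.ne', Int.emod_lt_of_pos t this⟩

namespace IsCausalVectorProcess

/-- Within a residue class modulo `B₁` the products `⟪f t, forwardAvg t⟫` are martingale
differences. -/
lemma eLpNorm_sum_inner_forwardAvg_class_le (H : IsCausalVectorProcess ν p C δ f) (hp : 4 < p)
    (T B B₁ : ℕ) (r : ℤ) :
    eLpNorm (fun x => ∑ t ∈ (Finset.Icc (1 : ℤ) T).filter (· % (B₁ : ℤ) = r),
        ⟪f t x, forwardAvg ν T B B₁ f t x⟫) (ENNReal.ofReal (p / 2)) (Measure.infinitePi ν)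
      ≤ ENNReal.ofReal (√((Finset.Icc (1 : ℤ) T).filter (· % (B₁ : ℤ) = r)).card
        * (√(burkholderConst (p / 2)) * (√d * C * (√(burkholderConst p * (B₁ + 1 - B : ℕ)) * C)))) := by
  have hC := H.nonneg
  set β := √d * C * (√(burkholderConst p * (B₁ + 1 - B : ℕ)) * C) with hβ
  have hβ0 : 0 ≤ β := by positivity
  have hm : ∀ t, StronglyMeasurable fun x => ⟪f t x, forwardAvg ν T B B₁ f t x⟫ := fun t =>
    (H.measurable t).stronglyMeasurable.inner (H.stronglyMeasurable_forwardAvg T B B₁ t)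
  have hmem : ∀ t, MemLp (fun x => ⟪f t x, forwardAvg ν T B B₁ f t x⟫) (ENNReal.ofReal (p / 2))
      (Measure.infinitePi ν) := fun t => ⟨(hm t).aestronglyMeasurable,
    (H.eLpNorm_inner_forwardAvg_self_le hp T B B₁ t).trans_lt ENNReal.ofReal_lt_top⟩
  refine (eLpNorm_sum_le_of_integral_oddPow_eq_zero (p := p / 2) (by linarith) _ _ (fun _ => β)
    (fun t _ => (hm t).aestronglyMeasurable) (fun _ _ => hβ0)
    (fun t _ => H.eLpNorm_inner_forwardAvg_self_le hp T B B₁ t) ?_).trans ?_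
  · intro t ht J hJ hlt
    refine integral_mul_inner_eq_zero (S := Set.Iic t)
      (u := fun x => oddPow (p / 2) (∑ s ∈ J, ⟪f s x, forwardAvg ν T B B₁ f s x⟫))
      (fun x y hxy => ?_) (H.dependsOn t)
      ((dependsOn_forwardAvg T B B₁ t).mono fun i hi => by simpa using hi.1)
      (H.integrable_forwardAvg (by linarith) T B B₁ t)
      (H.integral_forwardAvg (by linarith) T B B₁ t)
      (integrable_oddPow_mul (by linarith) (memLp_finsetSum J fun s _ => hmem s) (hmem t))
    dsimp only
    congr 1
    refine Finset.sum_congr rfl fun s hs => ?_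
    have hst := hlt s hs
    have hs' := (Finset.mem_filter.1 (hJ hs)).2
    have ht' := (Finset.mem_filter.1 ht).2
    -- Distinct times of one class are at least `B₁` apart, so the forward window of the earlier
    -- time ends no later than `t`, and the earlier products depend only on innovations up to `t`.
    have hle : s + B₁ ≤ t := by
      obtain ⟨k, hk⟩ : (B₁ : ℤ) ∣ t - s := Int.ModEq.dvd (hs'.trans ht'.symm)
      have hk0 : 0 < k := by
        by_contra hk'
        have : (B₁ : ℤ) * k ≤ 0 := mul_nonpos_of_nonneg_of_nonpos (by positivity) (by linarith)
        omega
      have : (B₁ : ℤ) * 1 ≤ B₁ * k := by gcongr; omega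
      omega
    rw [H.dependsOn s fun i hi => hxy i (by simp at hi ⊢; omega),
      dependsOn_forwardAvg (ν := ν) (f := f) T B B₁ s fun i hi => hxy i (by simp at hi ⊢; omega)]
  · refine ENNReal.ofReal_le_ofReal (le_of_eq ?_)
    rw [Finset.sum_const, nsmul_eq_mul, mul_left_comm,
      Real.sqrt_mul (Nat.cast_nonneg _), Real.sqrt_mul (burkholderConst_pos (by linarith)).le,
      Real.sqrt_sq hβ0]

lemma eLpNorm_sum_inner_forwardAvg_le (H : IsCausalVectorProcess ν p C δ f) (hp : 4 < p)
    (T B B₁ : ℕ) (hB₁ : 0 < B₁) :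
    eLpNorm (fun x => ∑ t ∈ Finset.Icc (1 : ℤ) T, ⟪f t x, forwardAvg ν T B B₁ f t x⟫)
        (ENNReal.ofReal (p / 2)) (Measure.infinitePi ν)
      ≤ ENNReal.ofReal (√(B₁ * T) * (√(burkholderConst (p / 2))
        * (√d * C * (√(burkholderConst p * (B₁ + 1 - B : ℕ)) * C)))) := by
  have hC := H.nonneg
  have hB₁' : (0 : ℤ) < B₁ := by exact_mod_cast hB₁
  have e : (fun x => ∑ t ∈ Finset.Icc (1 : ℤ) T, ⟪f t x, forwardAvg ν T B B₁ f t x⟫)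
      = ∑ r ∈ Finset.Ico (0 : ℤ) B₁, fun x =>
        ∑ t ∈ (Finset.Icc (1 : ℤ) T).filter (· % (B₁ : ℤ) = r),
          ⟪f t x, forwardAvg ν T B B₁ f t x⟫ := by
    ext x
    rw [Finset.sum_apply]
    refine (Finset.sum_fiberwise_of_maps_to (fun t _ => ?_) _).symm
    simpa using ⟨Int.emod_nonneg t hB₁'.ne', Int.emod_lt_of_pos t hB₁'⟩
  rw [e]
  refine (eLpNorm_sum_le (fun r _ => (Finset.stronglyMeasurable_fun_sum _ fun t _ =>
    (H.measurable t).stronglyMeasurable.inner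
      (H.stronglyMeasurable_forwardAvg T B B₁ t)).aestronglyMeasurable)
    (by simp; linarith)).trans ?_
  refine (Finset.sum_le_sum fun r _ =>
    H.eLpNorm_sum_inner_forwardAvg_class_le hp T B B₁ r).trans ?_
  rw [← ENNReal.ofReal_sum_of_nonneg fun r _ => by positivity, ← Finset.sum_mul]
  gcongr
  exact sum_sqrt_card_emod_le T B₁ hB₁

/-- The error made in the forward sums by averaging out the innovations up to time `t`. -/
lemma eLpNorm_sum_sub_forwardAvg_le (H : IsCausalVectorProcess ν p C δ f) (hp : 2 ≤ p)
    (T B B₁ : ℕ) {ε : ℝ} (hε : ∑' j, δ (B + j) ≤ ENNReal.ofReal ε) (t : ℤ) :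
    eLpNorm (fun x => ∑ s ∈ forwardWindow T B B₁ t, f s x - forwardAvg ν T B B₁ f t x)
        (ENNReal.ofReal p) (Measure.infinitePi ν)
      ≤ ENNReal.ofReal (√d * ((B₁ + 1 - B : ℕ) * ε)) := by
  rw [ENNReal.ofReal_mul (Real.sqrt_nonneg _)]
  have hm : StronglyMeasurable fun x =>
      ∑ s ∈ forwardWindow T B B₁ t, f s x - forwardAvg ν T B B₁ f t x :=
    (Finset.stronglyMeasurable_fun_sum _ fun s _ => (H.measurable s).stronglyMeasurable).sub
      (H.stronglyMeasurable_forwardAvg T B B₁ t)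
  refine eLpNorm_le_of_inner hm.aestronglyMeasurable hp fun a ha => ?_
  have e : (fun x => ⟪a, ∑ s ∈ forwardWindow T B B₁ t, f s x - forwardAvg ν T B B₁ f t x⟫)
      =ᵐ[Measure.infinitePi ν] ∑ s ∈ forwardWindow T B B₁ t, fun x =>
        ⟪a, f s x⟫ - coordAvg ν (window s (s - t).toNat) (fun x => ⟪a, f s x⟫) x := by
    filter_upwards [H.coordAvg_inner_ae hp a fun s => window s (s - t).toNat] with x hx
    simp only [forwardAvg, inner_sub_right, inner_sum, Finset.sum_apply, hx,
      Finset.sum_sub_distrib]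
  have hH := H.inner hp ha
  rw [eLpNorm_congr_ae e]
  refine (eLpNorm_sum_le (fun s _ => ((hH.measurable s).stronglyMeasurable.sub
    (stronglyMeasurable_coordAvg ν _
      (hH.measurable s).stronglyMeasurable)).aestronglyMeasurable) (by simp; linarith)).trans ?_
  calc _ ≤ ∑ s ∈ forwardWindow T B B₁ t, ENNReal.ofReal ε := by
        refine Finset.sum_le_sum fun s hs => ?_
        refine (hH.eLpNorm_sub_coordAvg_le (by linarith) s _).trans (le_trans ?_ hε)
        simp only [forwardWindow, Finset.mem_Icc] at hs
        -- The window retains the last `s - t ≥ B` innovations, so the truncation error is a tail of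
        -- the series starting at or beyond `B`.
        obtain ⟨k, hk⟩ : ∃ k, (s - t).toNat = B + k := ⟨(s - t).toNat - B, by omega⟩
        rw [hk]
        simp_rw [add_assoc]
        exact ENNReal.tsum_comp_le_tsum_of_injective (f := fun j => k + j)
          (fun a b hab => by simpa using hab) fun j => δ (B + j)
    _ ≤ _ := by
        rw [Finset.sum_const, nsmul_eq_mul, ENNReal.ofReal_mul (Nat.cast_nonneg _),
          ENNReal.ofReal_natCast]
        gcongr
        exact card_forwardWindow_le T B B₁ t

/-- The one-sided quadratic form of the process. -/
lemma eLpNorm_sum_inner_forwardSum_le (H : IsCausalVectorProcess ν p C δ f) (hp : 4 < p)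
    (T B B₁ : ℕ) (hB₁ : 0 < B₁) {ε : ℝ} (hε0 : 0 ≤ ε)
    (hε : ∑' j, δ (B + j) ≤ ENNReal.ofReal ε) :
    eLpNorm (fun x => ∑ t ∈ Finset.Icc (1 : ℤ) T, ⟪f t x, ∑ s ∈ forwardWindow T B B₁ t, f s x⟫)
        (ENNReal.ofReal (p / 2)) (Measure.infinitePi ν)
      ≤ ENNReal.ofReal (√(B₁ * T) * (√(burkholderConst (p / 2))
        * (√d * C * (√(burkholderConst p * (B₁ + 1 - B : ℕ)) * C)))
        + T * (√d * C * (√d * ((B₁ + 1 - B : ℕ) * ε)))) := by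
  have hC := H.nonneg
  have hmG := H.stronglyMeasurable_forwardAvg T B B₁
  have hmf := fun t => (H.measurable t).stronglyMeasurable
  have hmd : ∀ t, StronglyMeasurable fun x =>
      ∑ s ∈ forwardWindow T B B₁ t, f s x - forwardAvg ν T B B₁ f t x := fun t =>
    (Finset.stronglyMeasurable_fun_sum _ fun s _ => hmf s).sub (hmG t)
  -- The forward sum is its decoupled part plus a remainder. The remainder is correlated with `f t`,
  -- so Hölder costs `√d` twice; the factor `ε` compensates.
  have e : (fun x => ∑ t ∈ Finset.Icc (1 : ℤ) T,
        ⟪f t x, ∑ s ∈ forwardWindow T B B₁ t, f s x⟫)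
      = (fun x => ∑ t ∈ Finset.Icc (1 : ℤ) T, ⟪f t x, forwardAvg ν T B B₁ f t x⟫)
        + ∑ t ∈ Finset.Icc (1 : ℤ) T, fun x =>
          ⟪f t x, ∑ s ∈ forwardWindow T B B₁ t, f s x - forwardAvg ν T B B₁ f t x⟫ := by
    ext x
    rw [Pi.add_apply, Finset.sum_apply, ← Finset.sum_add_distrib]
    exact Finset.sum_congr rfl fun t _ => by rw [inner_sub_right]; ring
  have hq : (1 : ℝ≥0∞) ≤ ENNReal.ofReal (p / 2) := by simp; linarith
  rw [e, ENNReal.ofReal_add (by positivity) (by positivity)]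
  refine (eLpNorm_add_le (Finset.stronglyMeasurable_fun_sum _ fun t _ =>
      (hmf t).inner (hmG t)).aestronglyMeasurable
    (Finset.stronglyMeasurable_sum _ fun t _ => (hmf t).inner (hmd t)).aestronglyMeasurable
    hq).trans (add_le_add (H.eLpNorm_sum_inner_forwardAvg_le hp T B B₁ hB₁) ?_)
  refine (eLpNorm_sum_le (fun t _ => ((hmf t).inner (hmd t)).aestronglyMeasurable) hq).trans ?_
  calc _ ≤ ∑ t ∈ Finset.Icc (1 : ℤ) T,
        ENNReal.ofReal (√d * C * (√d * ((B₁ + 1 - B : ℕ) * ε))) := by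
        refine Finset.sum_le_sum fun t _ => (eLpNorm_inner_le_mul (hmf t).aestronglyMeasurable
          (hmd t).aestronglyMeasurable (by linarith)).trans ?_
        rw [ENNReal.ofReal_mul (by positivity)]
        exact mul_le_mul' (H.eLpNorm_le (by linarith) t)
          (H.eLpNorm_sum_sub_forwardAvg_le (by linarith) T B B₁ hε t)
    _ = _ := by
        rw [Finset.sum_const, nsmul_eq_mul, ENNReal.ofReal_mul (Nat.cast_nonneg T),
          ENNReal.ofReal_natCast]
        simp

end IsCausalVectorProcess

end QuadraticForm

/-! ### Counting and summing over lagged pairs -/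

section LagPairs

/-- Each unordered pair is listed from its earlier time; `0 < B` excludes the diagonal. -/
lemma sum_lagPairs {T B B₁ : ℕ} (hB : 0 < B) (φ : ℤ → ℤ → ℝ) :
    ∑ q ∈ lagPairs T B B₁, φ q.1 q.2
      = ∑ t ∈ Finset.Icc (1 : ℤ) T, ∑ s ∈ forwardWindow T B B₁ t, (φ t s + φ s t) := by
  have hfw : ∀ t ∈ Finset.Icc (1 : ℤ) T, (Finset.Icc (1 : ℤ) T).filter
      (fun s => t < s ∧ (B : ℤ) ≤ |t - s| ∧ |t - s| ≤ (B₁ : ℤ)) = forwardWindow T B B₁ t := by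
    intro t ht
    rw [Finset.mem_Icc] at ht
    ext s
    simp only [forwardWindow, Finset.mem_filter, Finset.mem_Icc, le_min_iff]
    constructor
    · rintro ⟨⟨_, _⟩, h1, h2, h3⟩
      rw [abs_sub_comm, abs_of_pos (by omega)] at h2 h3
      omega
    · rintro ⟨h1, h2, h3⟩
      rw [abs_sub_comm, abs_of_pos (by omega)]
      omega
  have hsplit : ∀ t s : ℤ, (if (B : ℤ) ≤ |t - s| ∧ |t - s| ≤ (B₁ : ℤ) then φ t s else 0)
      = (if t < s ∧ (B : ℤ) ≤ |t - s| ∧ |t - s| ≤ (B₁ : ℤ) then φ t s else 0)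
        + (if s < t ∧ (B : ℤ) ≤ |s - t| ∧ |s - t| ≤ (B₁ : ℤ) then φ t s else 0) := by
    intro t s
    rw [abs_sub_comm s t]
    rcases lt_trichotomy t s with h | h | h
    · simp [h, h.le.not_gt]
    · subst h
      simp [hB.ne']
    · simp [h, h.le.not_gt]
  rw [lagPairs, Finset.sum_filter, Finset.sum_product]
  simp_rw [hsplit, Finset.sum_add_distrib]
  rw [Finset.sum_comm (f := fun t s =>
    if s < t ∧ (B : ℤ) ≤ |s - t| ∧ |s - t| ≤ (B₁ : ℤ) then φ t s else 0)]
  simp_rw [← Finset.sum_filter]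
  congr 1 <;> exact Finset.sum_congr rfl fun t ht => by rw [hfw t ht]

/-- Times up to `T - B₁ ≥ T/2` have a full forward window, and every such pair counts in both
orders, which cancels the factor `1/2`. -/
lemma le_lagCount {T B B₁ : ℕ} (hB : 0 < B) (hBB₁ : B < B₁) (hT : 2 * B₁ ≤ T) :
    ((B₁ + 1 - B : ℕ) : ℝ) * T ≤ lagCount T B B₁ := by
  have h := sum_lagPairs (T := T) (B₁ := B₁) hB fun _ _ => 1
  rw [Finset.sum_const, nsmul_eq_mul, mul_one] at h
  rw [lagCount, h]
  calc ((B₁ + 1 - B : ℕ) : ℝ) * T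
      ≤ ∑ t ∈ Finset.Icc (1 : ℤ) (T - B₁), ((B₁ + 1 - B : ℕ) : ℝ) * 2 := by
        rw [Finset.sum_const, Int.card_Icc, nsmul_eq_mul]
        have h1 : ((T : ℤ) - B₁ + 1 - 1).toNat = T - B₁ := by omega
        have h2 : (T : ℝ) ≤ ((T - B₁ : ℕ) : ℝ) * 2 := by
          rw [Nat.cast_sub (by omega)]
          have : (2 : ℝ) * B₁ ≤ T := by exact_mod_cast hT
          linarith
        rw [h1]
        nlinarith [Nat.cast_nonneg (α := ℝ) (B₁ + 1 - B)]
    _ ≤ ∑ t ∈ Finset.Icc (1 : ℤ) (T - B₁), ∑ s ∈ forwardWindow T B B₁ t, (1 + 1 : ℝ) := by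
        refine Finset.sum_le_sum fun t ht => ?_
        rw [Finset.mem_Icc] at ht
        have : (forwardWindow T B B₁ t).card = B₁ + 1 - B := by
          rw [forwardWindow, Int.card_Icc, min_eq_left (by omega)]; omega
        rw [Finset.sum_const, nsmul_eq_mul, this]
        norm_num
    _ ≤ _ := by
        refine Finset.sum_le_sum_of_subset_of_nonneg (Finset.Icc_subset_Icc_right (by omega))
          fun t _ _ => Finset.sum_nonneg fun s _ => by norm_num

/-- The number of admissible partners of the time `t`. -/
noncomputable def lagDegree (T B B₁ : ℕ) (t : ℤ) : ℕ := ((lagPairs T B B₁).filter (·.1 = t)).card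

lemma lagDegree_le (T B B₁ : ℕ) (t : ℤ) : lagDegree T B B₁ t ≤ 2 * (B₁ + 1 - B) := by
  have hsub : (lagPairs T B B₁).filter (·.1 = t) ⊆
      (Finset.Icc (t + B) (t + B₁) ∪ Finset.Icc (t - B₁) (t - B)).image fun s => (t, s) := by
    rintro ⟨u, s⟩ h
    simp only [lagPairs, Finset.mem_filter, Finset.mem_product, Finset.mem_Icc] at h
    obtain ⟨⟨-, h1, h2⟩, rfl⟩ := h
    simp only [Finset.mem_image, Finset.mem_union, Finset.mem_Icc]
    refine ⟨s, ?_, rfl⟩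
    rcases abs_cases (u - s) with ⟨h3, _⟩ | ⟨h3, _⟩ <;> rw [h3] at h1 h2 <;> omega
  refine (Finset.card_le_card hsub).trans (Finset.card_image_le.trans
    ((Finset.card_union_le _ _).trans ?_))
  rw [Int.card_Icc, Int.card_Icc]; omega

lemma sum_lagPairs_fst {V : Type*} [AddCommGroup V] [Module ℝ V] (T B B₁ : ℕ) (ψ : ℤ → V) :
    ∑ q ∈ lagPairs T B B₁, ψ q.1
      = ∑ t ∈ Finset.Icc (1 : ℤ) T, (lagDegree T B B₁ t : ℝ) • ψ t := by
  rw [← Finset.sum_fiberwise_of_maps_to (g := fun q : ℤ × ℤ => q.1) (t := Finset.Icc (1 : ℤ) T)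
    (fun q hq => by
      simp only [lagPairs, Finset.mem_filter, Finset.mem_product] at hq
      exact hq.1.1)]
  refine Finset.sum_congr rfl fun t _ => ?_
  rw [Finset.sum_congr rfl fun q hq => by rw [(Finset.mem_filter.1 hq).2], Finset.sum_const,
    lagDegree, Nat.cast_smul_eq_nsmul]

end LagPairs

/-! ### Noise of a single sample -/

section Noise

variable {d : ℕ}

/-- The sample mean of `y 1, …, y T`. -/
noncomputable def averageError (T : ℕ) (y : ℤ → EuclideanSpace ℝ (Fin d)) :
    EuclideanSpace ℝ (Fin d) := (T : ℝ)⁻¹ • ∑ t ∈ Finset.Icc (1 : ℤ) T, y t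

/-- The deviation of the normalized quadratic form of `μ + y` from `‖μ‖²`. -/
noncomputable def autoNoise (T B B₁ : ℕ) (μ : EuclideanSpace ℝ (Fin d))
    (y : ℤ → EuclideanSpace ℝ (Fin d)) : ℝ :=
  1 / lagCount T B B₁ * ∑ q ∈ lagPairs T B B₁, ⟪μ + y q.1, μ + y q.2⟫ - ‖μ‖ ^ 2

lemma autoNoise_eq {T B B₁ : ℕ} (hB : 0 < B) (hV : lagCount T B B₁ ≠ 0)
    (μ : EuclideanSpace ℝ (Fin d)) (y : ℤ → EuclideanSpace ℝ (Fin d)) :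
    autoNoise T B B₁ μ y
      = 2 / lagCount T B B₁ * ⟪μ, ∑ t ∈ Finset.Icc (1 : ℤ) T, (lagDegree T B B₁ t : ℝ) • y t⟫
        + 2 / lagCount T B B₁ * ∑ t ∈ Finset.Icc (1 : ℤ) T,
            ⟪y t, ∑ s ∈ forwardWindow T B B₁ t, y s⟫ := by
  have hlin : ∑ q ∈ lagPairs T B B₁, ⟪μ, y q.1⟫
      = ⟪μ, ∑ t ∈ Finset.Icc (1 : ℤ) T, (lagDegree T B B₁ t : ℝ) • y t⟫ := by
    rw [← sum_lagPairs_fst, inner_sum]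
  have hsymm : ∑ q ∈ lagPairs T B B₁, ⟪μ, y q.2⟫ = ∑ q ∈ lagPairs T B B₁, ⟪μ, y q.1⟫ := by
    rw [sum_lagPairs hB fun _ s => ⟪μ, y s⟫, sum_lagPairs hB fun t _ => ⟪μ, y t⟫]
    simp_rw [add_comm]
  have hquad : ∑ q ∈ lagPairs T B B₁, ⟪y q.1, y q.2⟫
      = 2 * ∑ t ∈ Finset.Icc (1 : ℤ) T, ⟪y t, ∑ s ∈ forwardWindow T B B₁ t, y s⟫ := by
    rw [sum_lagPairs hB fun t s => ⟪y t, y s⟫, Finset.mul_sum]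
    refine Finset.sum_congr rfl fun t _ => ?_
    rw [inner_sum, Finset.mul_sum]
    exact Finset.sum_congr rfl fun s _ => by rw [real_inner_comm (y t) (y s)]; ring
  have hexp : ∑ q ∈ lagPairs T B B₁, ⟪μ + y q.1, μ + y q.2⟫
      = lagCount T B B₁ * ‖μ‖ ^ 2 + ∑ q ∈ lagPairs T B B₁, ⟪μ, y q.2⟫
        + ∑ q ∈ lagPairs T B B₁, ⟪μ, y q.1⟫ + ∑ q ∈ lagPairs T B B₁, ⟪y q.1, y q.2⟫ := by
    rw [lagCount, ← nsmul_eq_mul, ← Finset.sum_const, ← Finset.sum_add_distrib,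
      ← Finset.sum_add_distrib, ← Finset.sum_add_distrib]
    refine Finset.sum_congr rfl fun q _ => ?_
    rw [inner_add_left, inner_add_right, inner_add_right, real_inner_self_eq_norm_sq,
      real_inner_comm μ (y q.1)]
    ring
  rw [autoNoise, hexp, hsymm, hlin, hquad]
  field_simp
  ring

variable {E : Type*} [MeasurableSpace E] {ν : ℤ → Measure E} [∀ i, IsProbabilityMeasure (ν i)]
  {p C : ℝ} {δ : ℕ → ℝ≥0∞} {f : ℤ → (ℤ → E) → EuclideanSpace ℝ (Fin d)}

namespace IsCausalVectorProcess

lemma measurable_averageError (H : IsCausalVectorProcess ν p C δ f) (T : ℕ) :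
    Measurable fun x => averageError T fun t => f t x := by
  have := H.measurable
  unfold averageError; fun_prop

lemma eLpNorm_inner_averageError_le (H : IsCausalVectorProcess ν p C δ f) (hp : 2 < p) {T : ℕ}
    (a : EuclideanSpace ℝ (Fin d)) :
    eLpNorm (fun x => ⟪a, averageError T fun t => f t x⟫) (ENNReal.ofReal p)
      (Measure.infinitePi ν) ≤ ENNReal.ofReal (‖a‖ * (√(burkholderConst p) * C / √T)) := by
  have h := H.eLpNorm_inner_sum_le hp (Finset.Icc (1 : ℤ) T) (fun _ => (T : ℝ)⁻¹) a
  simp only [averageError, Finset.smul_sum]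
  refine h.trans_eq ?_
  congr 2
  have hs : ∑ s ∈ Finset.Icc (1 : ℤ) T, ((T : ℝ)⁻¹) ^ 2 = (T : ℝ)⁻¹ := by
    rw [Finset.sum_const, nsmul_eq_mul, Int.card_Icc]
    rcases Nat.eq_zero_or_pos T with rfl | hT
    · simp
    · have : (T : ℝ) ≠ 0 := by positivity
      simp; field_simp
  rw [hs, Real.sqrt_mul (burkholderConst_pos hp).le, Real.sqrt_inv]
  ring

lemma eLpNorm_averageError_le (H : IsCausalVectorProcess ν p C δ f) (hp : 2 < p) {T : ℕ} :
    eLpNorm (fun x => averageError T fun t => f t x) (ENNReal.ofReal p)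
      (Measure.infinitePi ν) ≤ ENNReal.ofReal (√d * (√(burkholderConst p) * C / √T)) := by
  rw [ENNReal.ofReal_mul (Real.sqrt_nonneg _)]
  exact eLpNorm_le_of_inner (H.measurable_averageError T).aestronglyMeasurable hp.le
    fun a ha => by simpa [ha] using H.eLpNorm_inner_averageError_le hp (T := T) a

lemma measurable_autoNoise (H : IsCausalVectorProcess ν p C δ f) (T B B₁ : ℕ)
    (μ : EuclideanSpace ℝ (Fin d)) : Measurable fun x => autoNoise T B B₁ μ fun t => f t x := by
  have := H.measurable
  unfold autoNoise; fun_prop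

/-- The three summands come from the linear term, the decoupled quadratic form and the decoupling
error, each divided by the number of pairs, which is at least `L T`. -/
lemma eLpNorm_autoNoise_le (H : IsCausalVectorProcess ν p C δ f) (hp : 4 < p) {T B B₁ : ℕ}
    (hB : 0 < B) (hBB₁ : B < B₁) (hT : 2 * B₁ ≤ T) (μ : EuclideanSpace ℝ (Fin d)) {ε : ℝ}
    (hε0 : 0 ≤ ε) (hε : ∑' j, δ (B + j) ≤ ENNReal.ofReal ε) :
    eLpNorm (fun x => autoNoise T B B₁ μ fun t => f t x) (ENNReal.ofReal (p / 2))
      (Measure.infinitePi ν)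
      ≤ ENNReal.ofReal (4 * √(burkholderConst p) * C * (‖μ‖ / √T)
        + (2 * √(burkholderConst p) * √(burkholderConst (p / 2)) * C ^ 2
            * (√(B₁ / (B₁ + 1 - B : ℕ)) * (√d / √T)) + 2 * C * (d * ε))) := by
  have hC := H.nonneg
  have hmf := fun t => (H.measurable t)
  set L : ℝ := ((B₁ + 1 - B : ℕ) : ℝ) with hL
  have hL0 : 0 < L := by
    have : 0 < B₁ + 1 - B := by omega
    rw [hL]; exact_mod_cast this
  have hT0 : (0 : ℝ) < T := by
    have : 0 < T := by omega
    exact_mod_cast this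
  have hV := le_lagCount hB hBB₁ hT
  rw [← hL] at hV
  set V := lagCount T B B₁
  have hLT : 0 < L * T := by positivity
  have hV0 : 0 < V := hLT.trans_le hV
  have hVle : 2 / V ≤ 2 / (L * T) := by gcongr
  have hle : ENNReal.ofReal (p / 2) ≤ ENNReal.ofReal p := ENNReal.ofReal_le_ofReal (by linarith)
  have hA := (burkholderConst_pos (p := p) (by linarith)).le
  have hscale : ∀ F : (ℤ → E) → ℝ, ∀ b : ℝ, 0 ≤ b → eLpNorm F (ENNReal.ofReal (p / 2))
      (Measure.infinitePi ν) ≤ ENNReal.ofReal b →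
      eLpNorm (fun x => 2 / V * F x) (ENNReal.ofReal (p / 2)) (Measure.infinitePi ν)
        ≤ ENNReal.ofReal (2 / (L * T) * b) := by
    intro F b hb hF
    refine (eLpNorm_const_smul_le (c := 2 / V) (f := F)).trans ?_
    rw [Real.enorm_eq_ofReal (by positivity), ENNReal.ofReal_mul (by positivity)]
    gcongr
  have hTT : √(T : ℝ) * √T = T := Real.mul_self_sqrt hT0.le
  have hLL : √L * √L = L := Real.mul_self_sqrt hL0.le
  have hdd : √(d : ℝ) * √d = d := Real.mul_self_sqrt (Nat.cast_nonneg d)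
  have hsT : 0 < √(T : ℝ) := Real.sqrt_pos.2 hT0
  have hsL : 0 < √L := Real.sqrt_pos.2 hL0
  have e : (fun x => autoNoise T B B₁ μ fun t => f t x)
      = (fun x => 2 / V * ⟪μ, ∑ t ∈ Finset.Icc (1 : ℤ) T, (lagDegree T B B₁ t : ℝ) • f t x⟫)
        + fun x => 2 / V * ∑ t ∈ Finset.Icc (1 : ℤ) T,
            ⟪f t x, ∑ s ∈ forwardWindow T B B₁ t, f s x⟫ := by
    ext x; rw [autoNoise_eq hB hV0.ne']; rfl
  have hmlin : Measurable fun x =>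
      ⟪μ, ∑ t ∈ Finset.Icc (1 : ℤ) T, (lagDegree T B B₁ t : ℝ) • f t x⟫ := by fun_prop
  have hmquad : Measurable fun x =>
      ∑ t ∈ Finset.Icc (1 : ℤ) T, ⟪f t x, ∑ s ∈ forwardWindow T B B₁ t, f s x⟫ := by fun_prop
  rw [e, ENNReal.ofReal_add (by positivity) (by positivity)]
  refine (eLpNorm_add_le (hmlin.const_mul _).aestronglyMeasurable
    (hmquad.const_mul _).aestronglyMeasurable (by simp; linarith)).trans
    (add_le_add ?_ ?_)
  · have h1 := (eLpNorm_le_eLpNorm_of_exponent_le hle hmlin.aestronglyMeasurable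
      ).trans (H.eLpNorm_inner_sum_le (by linarith) (Finset.Icc (1 : ℤ) T)
        (fun t => (lagDegree T B B₁ t : ℝ)) μ)
    have hnn : 0 ≤ ‖μ‖ * (√(burkholderConst p * ∑ s ∈ Finset.Icc (1 : ℤ) T,
        (lagDegree T B B₁ s : ℝ) ^ 2) * C) :=
      mul_nonneg (norm_nonneg _) (mul_nonneg (Real.sqrt_nonneg _) hC)
    have h3 := hscale _ _ hnn h1
    refine h3.trans (ENNReal.ofReal_le_ofReal ?_)
    -- Every time has at most `2L` partners, so the weights have `ℓ²` norm at most `2L√T`; the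
    -- factor `L` cancels against the normalization.
    have h2 : √(burkholderConst p * ∑ s ∈ Finset.Icc (1 : ℤ) T, (lagDegree T B B₁ s : ℝ) ^ 2)
        ≤ √(burkholderConst p) * (√T * (2 * L)) := by
      rw [Real.sqrt_mul hA]
      gcongr
      refine Real.sqrt_le_iff.2 ⟨by positivity, ?_⟩
      calc _ ≤ ∑ s ∈ Finset.Icc (1 : ℤ) T, (2 * L) ^ 2 := by
            gcongr with s _
            have := lagDegree_le T B B₁ s
            rw [hL]; exact_mod_cast this
        _ = _ := by
            rw [Finset.sum_const, nsmul_eq_mul, Int.card_Icc, mul_pow (√(T : ℝ)),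
              Real.sq_sqrt hT0.le]
            simp
    calc _ ≤ 2 / (L * T) * (‖μ‖ * (√(burkholderConst p) * (√T * (2 * L)) * C)) := by gcongr
      _ = 2 / (L * (√T * √T)) * (‖μ‖ * (√(burkholderConst p) * (√T * (2 * L)) * C)) := by
          rw [hTT]
      _ = _ := by field_simp; ring
  · have h1 := H.eLpNorm_sum_inner_forwardSum_le hp T B B₁ (by omega) hε0 hε
    rw [← hL] at h1
    refine (hscale _ _ (by positivity) h1).trans (ENNReal.ofReal_le_ofReal (le_of_eq ?_))
    rw [Real.sqrt_mul (Nat.cast_nonneg B₁), Real.sqrt_mul hA, Real.sqrt_div (Nat.cast_nonneg B₁)]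
    calc _ = 2 / (√L * √L * (√T * √T)) * (√B₁ * √T * (√(burkholderConst (p / 2))
          * (√d * C * (√(burkholderConst p) * √L * C))))
          + 2 / (L * T) * (T * (√d * √d * C * (L * ε))) := by rw [hLL, hTT]; ring
      _ = _ := by rw [hdd]; field_simp

end IsCausalVectorProcess

end Noise

/-! ### Transfer to the given error processes -/

section ErrorSeries

variable {Ω E : Type*} [MeasurableSpace Ω] [MeasurableSpace E] {P : Measure Ω}
  [IsProbabilityMeasure P] {d : ℕ} {e : ℤ → Ω → E} {g : ℤ → (ℕ → E) → EuclideanSpace ℝ (Fin d)}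
  {M α : ℝ} {C : ℝ≥0}

namespace IsShortRangeDependent

omit [IsProbabilityMeasure P] in
lemma measurePreserving_innovation (h : IsShortRangeDependent P e g M α C)
    [∀ i, IsProbabilityMeasure (P.map (e i))] :
    MeasurePreserving (fun ω i => e i ω) P (Measure.infinitePi fun i => P.map (e i)) :=
  ⟨measurable_pi_lambda _ h.measurable_innovation,
    h.indep_innovation.map_fun_eq_infinitePi_map h.measurable_innovation⟩

omit [IsProbabilityMeasure P] in
lemma tsum_dependenceMeasure_le (h : IsShortRangeDependent P e g M α C) (s : ℕ) :
    ∑' j, dependenceMeasure P e g M (s + j) ≤ ENNReal.ofReal (C * (1 + s : ℝ) ^ (-α)) := by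
  have h1 := h.dependence_le s
  have h2 : ((1 + s : ℕ) : ℝ≥0∞) = ENNReal.ofReal (1 + s : ℝ) := by
    rw [← ENNReal.ofReal_natCast]; congr 1; push_cast; rfl
  have hpos : (0 : ℝ) < 1 + s := by positivity
  rw [h2, ENNReal.ofReal_rpow_of_pos hpos, mul_comm] at h1
  rw [Real.rpow_neg hpos.le, ← div_eq_mul_inv, ENNReal.ofReal_div_of_pos (by positivity),
    ENNReal.ofReal_coe_nnreal]
  rwa [ENNReal.le_div_iff_mul_le (Or.inl (by simp only [ne_eq, ENNReal.ofReal_eq_zero, not_le]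
                                             positivity)) (Or.inl ENNReal.ofReal_ne_top)]

/-- The error process, transported to the space of innovation sequences. -/
lemma causal_model (h : IsShortRangeDependent P e g M α C)
    [∀ i, IsProbabilityMeasure (P.map (e i))] :
    IsCausalVectorProcess (fun i => P.map (e i)) M C (dependenceMeasure P e g M)
      (fun t x => g t fun j => x (t - j)) := by
  have hφ := h.measurePreserving_innovation
  have hm : ∀ t : ℤ, Measurable fun x : ℤ → E => g t fun j : ℕ => x (t - j) := fun t =>
    (h.measurable_function t).comp (measurable_pi_lambda _ fun j => measurable_pi_apply _)
  refine ⟨C.2, hm, fun t x y hxy => ?_, fun t => ?_, fun t a ha => ?_, fun t a ha j => ?_, ?_⟩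
  · exact congrArg (g t) (funext fun j => hxy _ (by simp))
  · rw [← hφ.map_eq, integral_map hφ.measurable.aemeasurable (hm t).aestronglyMeasurable]
    exact h.mean_zero t
  · rw [← eLpNorm_comp_measurePreserving ((hm t).const_inner).aestronglyMeasurable hφ,
      ENNReal.ofReal_coe_nnreal]
    exact h.moment_le t a ha
  · have hmeas : Measurable fun q : (ℤ → E) × (ℤ → E) =>
        ⟪a, g t (fun k : ℕ => q.1 (t - k))
          - g t (fun k : ℕ => splice {t - (j : ℤ)}ᶜ q.1 q.2 (t - k))⟫ :=
      (((hm t).comp measurable_fst).sub ((hm t).comp (measurable_splice _))).const_inner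
    -- The pair of innovation paths maps `P.prod P` to the product of the two path laws; resampling
    -- one innovation becomes splicing off one coordinate.
    rw [← eLpNorm_comp_measurePreserving hmeas.aestronglyMeasurable (hφ.prod hφ)]
    have e1 : (fun q : (ℤ → E) × (ℤ → E) =>
        ⟪a, g t (fun k : ℕ => q.1 (t - k))
          - g t (fun k : ℕ => splice {t - (j : ℤ)}ᶜ q.1 q.2 (t - k))⟫) ∘
          Prod.map (fun ω i => e i ω) (fun ω i => e i ω)
        = fun ω : Ω × Ω => ⟪a, errorSeries e g t ω.1 - coupledErrorSeries e g t j ω⟫ := by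
      ext ω
      simp only [Function.comp, errorSeries, coupledErrorSeries]
      congr 3
      ext k
      by_cases hk : k = j
      · subst hk; simp [splice]
      · have : t - (k : ℤ) ∈ ({t - (j : ℤ)}ᶜ : Set ℤ) := by
          simp only [Set.mem_compl_iff, Set.mem_singleton_iff]; omega
        rw [splice_apply_of_mem this, if_neg hk]; rfl
    rw [e1]
    exact le_iSup_of_le t (le_iSup_of_le a (le_iSup_of_le ha le_rfl))
  -- At `s = 0` the weight `(1 + s)^(-α)` equals one and the tail is the whole series.
  · simpa using h.tsum_dependenceMeasure_le 0

omit [IsProbabilityMeasure P] in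
lemma measurable_errorSeries (h : IsShortRangeDependent P e g M α C) (t : ℤ) :
    Measurable (errorSeries e g t) :=
  (h.measurable_function t).comp (measurable_pi_lambda _ fun _ => h.measurable_innovation _)

lemma eLpNorm_inner_averageError_le (h : IsShortRangeDependent P e g M α C) (hM : 2 < M) {T : ℕ}
    (a : EuclideanSpace ℝ (Fin d)) :
    eLpNorm (fun ω => ⟪a, averageError T fun t => errorSeries e g t ω⟫) (ENNReal.ofReal M) P
      ≤ ENNReal.ofReal (‖a‖ * (√(burkholderConst M) * C / √T)) := by
  have (i : ℤ) : IsProbabilityMeasure (P.map (e i)) :=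
    Measure.isProbabilityMeasure_map (h.measurable_innovation i).aemeasurable
  have H := h.causal_model
  refine le_trans (le_of_eq ?_) (H.eLpNorm_inner_averageError_le hM (T := T) a)
  rw [← eLpNorm_comp_measurePreserving
    ((H.measurable_averageError T).const_inner).aestronglyMeasurable
    h.measurePreserving_innovation]
  rfl

lemma eLpNorm_averageError_le (h : IsShortRangeDependent P e g M α C) (hM : 2 < M) {T : ℕ} :
    eLpNorm (fun ω => averageError T fun t => errorSeries e g t ω) (ENNReal.ofReal M) P
      ≤ ENNReal.ofReal (√d * (√(burkholderConst M) * C / √T)) := by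
  have (i : ℤ) : IsProbabilityMeasure (P.map (e i)) :=
    Measure.isProbabilityMeasure_map (h.measurable_innovation i).aemeasurable
  have H := h.causal_model
  refine le_trans (le_of_eq ?_) (H.eLpNorm_averageError_le hM (T := T))
  rw [← eLpNorm_comp_measurePreserving (H.measurable_averageError T).aestronglyMeasurable
    h.measurePreserving_innovation]
  rfl

lemma eLpNorm_autoNoise_le (h : IsShortRangeDependent P e g M α C) (hM : 4 < M) {T B B₁ : ℕ}
    (hB : 0 < B) (hBB₁ : B < B₁) (hT : 2 * B₁ ≤ T) (μ : EuclideanSpace ℝ (Fin d)) :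
    eLpNorm (fun ω => autoNoise T B B₁ μ fun t => errorSeries e g t ω)
      (ENNReal.ofReal (M / 2)) P
      ≤ ENNReal.ofReal (4 * √(burkholderConst M) * C * (‖μ‖ / √T)
        + (2 * √(burkholderConst M) * √(burkholderConst (M / 2)) * C ^ 2
            * (√(B₁ / (B₁ + 1 - B : ℕ)) * (√d / √T))
          + 2 * C * (d * (C * (1 + B : ℝ) ^ (-α))))) := by
  have (i : ℤ) : IsProbabilityMeasure (P.map (e i)) :=
    Measure.isProbabilityMeasure_map (h.measurable_innovation i).aemeasurable
  have H := h.causal_model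
  refine le_trans (le_of_eq ?_) (H.eLpNorm_autoNoise_le hM hB hBB₁ hT μ (by positivity)
    (h.tsum_dependenceMeasure_le B))
  rw [← eLpNorm_comp_measurePreserving (H.measurable_autoNoise T B B₁ μ).aestronglyMeasurable
    h.measurePreserving_innovation]
  rfl

end IsShortRangeDependent

end ErrorSeries

/-! ### Noise in the comparison of two populations -/

section PairNoise

variable {d : ℕ}

/-- The deviation of `√d R̂_k` from `‖μ_k - μ_1‖²`. -/
noncomputable def pairNoise (T : ℕ → ℕ) (B B₁ : ℕ) (μ : ℕ → EuclideanSpace ℝ (Fin d))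
    (y : ℕ → ℤ → EuclideanSpace ℝ (Fin d)) (k : ℕ) : ℝ :=
  autoNoise (T k) B B₁ (μ k) (y k) + autoNoise (T 1) B B₁ (μ 1) (y 1)
    - 2 * (⟪μ k, averageError (T 1) (y 1)⟫ + ⟪μ 1, averageError (T k) (y k)⟫
      + ⟪averageError (T k) (y k), averageError (T 1) (y 1)⟫)

lemma smul_sum_add_eq {T : ℕ} (hT : T ≠ 0) (μ : EuclideanSpace ℝ (Fin d))
    (y : ℤ → EuclideanSpace ℝ (Fin d)) :
    (T : ℝ)⁻¹ • ∑ t ∈ Finset.Icc (1 : ℤ) T, (μ + y t) = μ + averageError T y := by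
  have : (T : ℝ) ≠ 0 := by exact_mod_cast hT
  rw [Finset.sum_add_distrib, smul_add, averageError, Finset.sum_const, Int.card_Icc,
    ← Nat.cast_smul_eq_nsmul ℝ, smul_smul]
  simp [this]

/-- The cross sum is the inner product of the two full sample means, so the deterministic parts
combine to `‖μ k‖² + ‖μ 1‖² - 2⟪μ k, μ 1⟫`. -/
lemma pairStatistic_eq {T : ℕ → ℕ} {B B₁ k : ℕ} (hT : T k ≠ 0) (hT1 : T 1 ≠ 0)
    (μ : ℕ → EuclideanSpace ℝ (Fin d)) (y : ℕ → ℤ → EuclideanSpace ℝ (Fin d)) :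
    pairStatistic T B B₁ (fun k t => μ k + y k t) k
      = 1 / √(d : ℝ) * (‖μ k - μ 1‖ ^ 2 + pairNoise T B B₁ μ y k) := by
  have hcross : ((T k : ℝ)⁻¹ * (T 1 : ℝ)⁻¹) * ∑ t₁ ∈ Finset.Icc (1 : ℤ) (T k),
      ∑ t₂ ∈ Finset.Icc (1 : ℤ) (T 1), ⟪μ k + y k t₁, μ 1 + y 1 t₂⟫
      = ⟪μ k + averageError (T k) (y k), μ 1 + averageError (T 1) (y 1)⟫ := by
    rw [← smul_sum_add_eq hT, ← smul_sum_add_eq hT1, real_inner_smul_left, real_inner_smul_right,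
      sum_inner, mul_assoc]
    simp_rw [inner_sum]
  have h1 : ∀ j, 1 / (lagCount (T j) B B₁ * √(d : ℝ))
      * ∑ q ∈ lagPairs (T j) B B₁, ⟪μ j + y j q.1, μ j + y j q.2⟫
      = 1 / √(d : ℝ) * (autoNoise (T j) B B₁ (μ j) (y j) + ‖μ j‖ ^ 2) := fun j => by
    rw [autoNoise, one_div_mul_eq_div, mul_comm (lagCount _ _ _), ← div_div]; ring
  have h2 : 2 / ((T k : ℝ) * (T 1 : ℝ) * √(d : ℝ)) * ∑ t₁ ∈ Finset.Icc (1 : ℤ) (T k),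
      ∑ t₂ ∈ Finset.Icc (1 : ℤ) (T 1), ⟪μ k + y k t₁, μ 1 + y 1 t₂⟫
      = 1 / √(d : ℝ) * (2 * ⟪μ k + averageError (T k) (y k),
          μ 1 + averageError (T 1) (y 1)⟫) := by
    rw [← hcross, div_eq_mul_inv, mul_inv, mul_inv]; ring
  rw [pairStatistic, h1, h1, h2, pairNoise, inner_add_left, inner_add_right, inner_add_right,
    norm_sub_sq_real, real_inner_comm (μ 1) (averageError (T k) (y k))]
  ring

variable {Ω E : Type*} [MeasurableSpace Ω] [MeasurableSpace E] {P : Measure Ω}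
  [IsProbabilityMeasure P]

lemma eLpNorm_add_le_ofReal {F : Type*} [NormedAddCommGroup F] {P : Measure Ω} {p : ℝ≥0∞}
    (hp : 1 ≤ p) {f₁ f₂ : Ω → F} (hf₁ : AEStronglyMeasurable f₁ P)
    (hf₂ : AEStronglyMeasurable f₂ P) {b₁ b₂ : ℝ} (hb₁ : 0 ≤ b₁) (hb₂ : 0 ≤ b₂)
    (h₁ : eLpNorm f₁ p P ≤ ENNReal.ofReal b₁) (h₂ : eLpNorm f₂ p P ≤ ENNReal.ofReal b₂) :
    eLpNorm (f₁ + f₂) p P ≤ ENNReal.ofReal (b₁ + b₂) := by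
  rw [ENNReal.ofReal_add hb₁ hb₂]
  exact (eLpNorm_add_le hf₁ hf₂ hp).trans (add_le_add h₁ h₂)

/-- The bound for `pairNoise` in terms of the moment parameter, the dependence constant and a
bound `c` for the ratios of the sizes. -/
noncomputable def noiseConst (M C c : ℝ) : ℝ :=
  2 * (4 * √(burkholderConst M) * C * (c * √c)
    + (2 * √(burkholderConst M) * √(burkholderConst (M / 2)) * C ^ 2 * (√2 * √c) + 2 * C * c))
  + 2 * (2 * (c * √c * (√(burkholderConst M) * C)) + (√c * (√(burkholderConst M) * C)) ^ 2)

lemma noiseConst_nonneg {M C c : ℝ} (hC : 0 ≤ C) (hc : 0 ≤ c) : 0 ≤ noiseConst M C c := by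
  unfold noiseConst; positivity

/-- The exponent `M/2` is forced by products of two errors, each having `M` moments. With the ratios
bounded by `c`, one has `√(d/T) ≤ √c` and `‖μ‖/√T ≤ c√c`, which makes every term bounded. -/
lemma eLpNorm_pairNoise_le {T : ℕ → ℕ} {B B₁ k : ℕ} {μ : ℕ → EuclideanSpace ℝ (Fin d)}
    {e : ℕ → ℤ → Ω → E} {g : ℕ → ℤ → (ℕ → E) → EuclideanSpace ℝ (Fin d)} {M α c : ℝ} {C : ℝ≥0}
    (hM : 4 < M) (hc : 0 ≤ c) (hB : 0 < B) (hBB₁ : B < B₁)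
    (hL : (B₁ : ℝ) ≤ 2 * (B₁ + 1 - B : ℕ)) (hε : d * (C * (1 + B : ℝ) ^ (-α)) ≤ c)
    (h : ∀ j ∈ ({k, 1} : Set ℕ), IsShortRangeDependent P (e j) (g j) M α C ∧ 2 * B₁ ≤ T j ∧
      (d : ℝ) ≤ c * T j ∧ ‖μ j‖ ≤ c * √d) :
    eLpNorm (fun ω => pairNoise T B B₁ μ (fun k t => errorSeries (e k) (g k) t ω) k)
      (ENNReal.ofReal (M / 2)) P ≤ ENNReal.ofReal (noiseConst M C c) := by
  have hC : (0 : ℝ) ≤ C := C.2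
  have hMM : ENNReal.ofReal (M / 2) ≤ ENNReal.ofReal M := ENNReal.ofReal_le_ofReal (by linarith)
  have hq : (1 : ℝ≥0∞) ≤ ENNReal.ofReal (M / 2) := by simp; linarith
  have hTpos : ∀ j ∈ ({k, 1} : Set ℕ), 0 < √(T j : ℝ) := fun j hj => by
    have := (h j hj).2.1
    have : 0 < T j := by omega
    positivity
  have hdT : ∀ j ∈ ({k, 1} : Set ℕ), √(d : ℝ) ≤ √c * √(T j : ℝ) := fun j hj => by
    rw [← Real.sqrt_mul hc]
    exact Real.sqrt_le_sqrt (h j hj).2.2.1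
  have hdT' : ∀ j ∈ ({k, 1} : Set ℕ), √(d : ℝ) / √(T j : ℝ) ≤ √c := fun j hj => by
    rw [div_le_iff₀ (hTpos j hj)]; exact hdT j hj
  have hμT : ∀ i ∈ ({k, 1} : Set ℕ), ∀ j ∈ ({k, 1} : Set ℕ),
      ‖μ i‖ / √(T j : ℝ) ≤ c * √c := fun i hi j hj => by
    rw [div_le_iff₀ (hTpos j hj), mul_assoc]
    exact (h i hi).2.2.2.trans (by gcongr; exact hdT j hj)
  have hy : ∀ j ∈ ({k, 1} : Set ℕ), ∀ t, Measurable (errorSeries (e j) (g j) t) := fun j hj =>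
    (h j hj).1.measurable_errorSeries
  have hk : k ∈ ({k, 1} : Set ℕ) := by simp
  have h1 : 1 ∈ ({k, 1} : Set ℕ) := by simp
  have mavg : ∀ j ∈ ({k, 1} : Set ℕ), AEStronglyMeasurable
      (fun ω => averageError (T j) fun t => errorSeries (e j) (g j) t ω) P := fun j hj => by
    have := hy j hj
    exact Measurable.aestronglyMeasurable (by unfold averageError; fun_prop)
  have mauto : ∀ j ∈ ({k, 1} : Set ℕ), AEStronglyMeasurable
      (fun ω => autoNoise (T j) B B₁ (μ j) fun t => errorSeries (e j) (g j) t ω) P :=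
    fun j hj => by
      have := hy j hj
      exact Measurable.aestronglyMeasurable (by unfold autoNoise; fun_prop)
  have hratio : √((B₁ : ℝ) / (B₁ + 1 - B : ℕ)) ≤ √2 := by
    have : (0 : ℝ) < (B₁ + 1 - B : ℕ) := by
      have : 0 < B₁ + 1 - B := by omega
      exact_mod_cast this
    gcongr
    rwa [div_le_iff₀ this]
  have bauto : ∀ j ∈ ({k, 1} : Set ℕ), eLpNorm
      (fun ω => autoNoise (T j) B B₁ (μ j) fun t => errorSeries (e j) (g j) t ω)
      (ENNReal.ofReal (M / 2)) P ≤ ENNReal.ofReal (4 * √(burkholderConst M) * C * (c * √c)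
        + (2 * √(burkholderConst M) * √(burkholderConst (M / 2)) * C ^ 2 * (√2 * √c)
          + 2 * C * c)) := fun j hj => by
    refine ((h j hj).1.eLpNorm_autoNoise_le hM hB hBB₁ (h j hj).2.1 (μ j)).trans
      (ENNReal.ofReal_le_ofReal ?_)
    gcongr
    · exact hμT j hj j hj
    · exact hdT' j hj
  have blin : ∀ i ∈ ({k, 1} : Set ℕ), ∀ j ∈ ({k, 1} : Set ℕ), eLpNorm
      (fun ω => ⟪μ i, averageError (T j) fun t => errorSeries (e j) (g j) t ω⟫)
      (ENNReal.ofReal (M / 2)) P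
        ≤ ENNReal.ofReal (c * √c * (√(burkholderConst M) * C)) := fun i hi j hj => by
    refine (eLpNorm_le_eLpNorm_of_exponent_le hMM (aestronglyMeasurable_const.inner
      (mavg j hj))).trans (((h j hj).1.eLpNorm_inner_averageError_le (by linarith) (μ i)).trans
        (ENNReal.ofReal_le_ofReal ?_))
    calc _ = ‖μ i‖ / √(T j : ℝ) * (√(burkholderConst M) * C) := by ring
      _ ≤ _ := by gcongr; exact hμT i hi j hj
  have bavg : ∀ j ∈ ({k, 1} : Set ℕ), eLpNorm
      (fun ω => averageError (T j) fun t => errorSeries (e j) (g j) t ω)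
      (ENNReal.ofReal M) P ≤ ENNReal.ofReal (√c * (√(burkholderConst M) * C)) := fun j hj => by
    refine ((h j hj).1.eLpNorm_averageError_le (by linarith)).trans
      (ENNReal.ofReal_le_ofReal ?_)
    calc _ = √(d : ℝ) / √(T j : ℝ) * (√(burkholderConst M) * C) := by ring
      _ ≤ _ := by gcongr; exact hdT' j hj
  have bquad : eLpNorm (fun ω => ⟪averageError (T k) fun t => errorSeries (e k) (g k) t ω,
      averageError (T 1) fun t => errorSeries (e 1) (g 1) t ω⟫) (ENNReal.ofReal (M / 2)) P
      ≤ ENNReal.ofReal ((√c * (√(burkholderConst M) * C)) ^ 2) := by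
    rw [sq, ENNReal.ofReal_mul (by positivity)]
    exact (eLpNorm_inner_le_mul (mavg k hk) (mavg 1 h1) (by linarith)).trans
      (mul_le_mul' (bavg k hk) (bavg 1 h1))
  have mlin : ∀ i j, j ∈ ({k, 1} : Set ℕ) → AEStronglyMeasurable
      (fun ω => ⟪μ i, averageError (T j) fun t => errorSeries (e j) (g j) t ω⟫) P :=
    fun i j hj => aestronglyMeasurable_const.inner (mavg j hj)
  have mquad := (mavg k hk).inner (𝕜 := ℝ) (mavg 1 h1)
  have hsum := eLpNorm_add_le_ofReal hq ((mlin k 1 h1).add (mlin 1 k hk)) mquad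
    (by positivity) (by positivity)
    (eLpNorm_add_le_ofReal hq (mlin k 1 h1) (mlin 1 k hk) (by positivity) (by positivity)
      (blin k hk 1 h1) (blin 1 h1 k hk)) bquad
  have hsmul : eLpNorm ((-2 : ℝ) • _) (ENNReal.ofReal (M / 2)) P ≤ _ :=
    (eLpNorm_const_smul_le (c := (-2 : ℝ))).trans (mul_le_mul_right hsum ‖(-2 : ℝ)‖ₑ)
  rw [Real.enorm_eq_ofReal_abs, ← ENNReal.ofReal_mul (abs_nonneg _)] at hsmul
  have htot := eLpNorm_add_le_ofReal hq ((mauto k hk).add (mauto 1 h1))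
    ((((mlin k 1 h1).add (mlin 1 k hk)).add mquad).const_smul (-2 : ℝ))
    (by positivity) (by positivity)
    (eLpNorm_add_le_ofReal hq (mauto k hk) (mauto 1 h1) (by positivity) (by positivity)
      (bauto k hk) (bauto 1 h1)) hsmul
  refine (eLpNorm_congr_ae (Eventually.of_forall fun ω => ?_)).trans_le
    (htot.trans (ENNReal.ofReal_le_ofReal (le_of_eq ?_)))
  · simp only [pairNoise, Pi.add_apply, Pi.smul_apply, smul_eq_mul]
    ring
  rw [noiseConst, abs_neg, abs_two]
  ring

end PairNoise

/-! ### The lower tail in a fixed experiment -/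

section TailBound

variable {d : ℕ} {Ω E : Type*} [MeasurableSpace Ω] [MeasurableSpace E] {P : Measure Ω}
  [IsProbabilityMeasure P]

lemma minSize_le {K : ℕ} {T : ℕ → ℕ} {k : ℕ} (hk : k ∈ Finset.Icc 1 K) : minSize K T ≤ T k :=
  Nat.sInf_le ⟨k, by simpa using hk, rfl⟩

lemma testStatistic_eq {K : ℕ} {T : ℕ → ℕ} {B B₁ : ℕ} (hT : 0 < minSize K T)
    (μ : ℕ → EuclideanSpace ℝ (Fin d)) (y : ℕ → ℤ → EuclideanSpace ℝ (Fin d)) :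
    testStatistic K T B B₁ (fun k t => μ k + y k t)
      = 1 / √(d : ℝ) * (separation K μ + ∑ k ∈ Finset.Icc 2 K, pairNoise T B B₁ μ y k) := by
  rw [testStatistic, separation, ← Finset.sum_add_distrib, Finset.mul_sum]
  refine Finset.sum_congr rfl fun k hk => ?_
  rw [Finset.mem_Icc] at hk
  exact pairStatistic_eq (hT.trans_le (minSize_le (by simp; omega))).ne'
    (hT.trans_le (minSize_le (by simp; omega))).ne' μ y

omit [IsProbabilityMeasure P] in
/-- Markov's inequality for the `q`-th moment. -/
lemma measureReal_le_of_eLpNorm_le {X : Ω → ℝ} {q b x : ℝ} (hq : 0 < q) (hb : 0 ≤ b) (hx : 0 < x)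
    (hX : AEStronglyMeasurable X P) (h : eLpNorm X (ENNReal.ofReal q) P ≤ ENNReal.ofReal b) :
    P.real {ω | x ≤ |X ω|} ≤ (b / x) ^ q := by
  have h1 := meas_ge_le_mul_pow_eLpNorm_enorm P (p := ENNReal.ofReal q) (by simpa using hq)
    ENNReal.ofReal_ne_top hX (ε := ENNReal.ofReal x) (by simpa using hx) (by simp)
  have hset : {ω | ENNReal.ofReal x ≤ ‖X ω‖ₑ} = {ω | x ≤ |X ω|} := by
    ext ω
    simp only [Set.mem_ofPred_eq, Real.enorm_eq_ofReal_abs]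
    exact ENNReal.ofReal_le_ofReal_iff (abs_nonneg _)
  rw [hset, ENNReal.toReal_ofReal hq.le] at h1
  refine ENNReal.toReal_le_of_le_ofReal (by positivity) (h1.trans ?_)
  rw [← ENNReal.ofReal_rpow_of_nonneg (by positivity) hq.le, ENNReal.ofReal_div_of_pos hx,
    ENNReal.div_eq_inv_mul, ENNReal.mul_rpow_of_nonneg _ _ hq.le]
  gcongr

lemma norm_le_of_forall_abs_le {v : EuclideanSpace ℝ (Fin d)} {b : ℝ} (hb : 0 ≤ b)
    (h : ∀ i, |v i| ≤ b) : ‖v‖ ≤ b * √(d : ℝ) := by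
  rw [EuclideanSpace.norm_eq]
  refine Real.sqrt_le_iff.2 ⟨by positivity, ?_⟩
  calc ∑ i, ‖v i‖ ^ 2 ≤ ∑ _i : Fin d, b ^ 2 := by
        gcongr with i; exact h i
    _ = _ := by
        rw [Finset.sum_const, Finset.card_univ, Fintype.card_fin, nsmul_eq_mul, mul_pow,
          Real.sq_sqrt (Nat.cast_nonneg d)]
        ring

/-- The lower tail of the normalized statistic in a fixed experiment. -/
lemma measureReal_scaledStatistic_le {K B B₁ : ℕ} {T : ℕ → ℕ} {μ : ℕ → EuclideanSpace ℝ (Fin d)}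
    {e : ℕ → ℤ → Ω → E} {g : ℕ → ℤ → (ℕ → E) → EuclideanSpace ℝ (Fin d)} {M α c γ : ℝ} {C : ℝ≥0}
    (hM : 4 < M) (hc : 0 < c) (hd : 1 ≤ d) (hB : 0 < B) (hBB₁ : B < B₁)
    (hB₁ : 2 * B₁ ≤ minSize K T) (hdT : (d : ℝ) ≤ c * minSize K T)
    (hTd : (minSize K T : ℝ) ≤ c * d) (hL : (B₁ : ℝ) ≤ 2 * (B₁ + 1 - B : ℕ))
    (hε : d * (C * (1 + B : ℝ) ^ (-α)) ≤ c) (hμ : ∀ k ∈ Finset.Icc 1 K, ∀ i, |μ k i| ≤ c)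
    (h : ∀ k ∈ Finset.Icc 1 K, IsShortRangeDependent P (e k) (g k) M α C)
    (hx : γ / √((minSize K T : ℝ) * ((B₁ : ℝ) - B)) < 1 / √(d : ℝ) * separation K μ) :
    P.real {ω | scaledStatistic K T B B₁ (observation μ e g ω) ≤ γ}
      ≤ (K * noiseConst M C c * √c) ^ (M / 2) / (√(minSize K T : ℝ) *
          (1 / √(d : ℝ) * separation K μ
            - γ / √((minSize K T : ℝ) * ((B₁ : ℝ) - B)))) ^ (M / 2) := by
  have hC : (0 : ℝ) ≤ C := C.2
  have hT0 : 0 < minSize K T := by omega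
  have hsT : 0 < √(minSize K T : ℝ) := Real.sqrt_pos.2 (by exact_mod_cast hT0)
  have hsd : 0 < √(d : ℝ) := Real.sqrt_pos.2 (by exact_mod_cast hd)
  have hs : 0 < √((minSize K T : ℝ) * ((B₁ : ℝ) - B)) := by
    have h1 : (0 : ℝ) < minSize K T := by exact_mod_cast hT0
    have h2 : (B : ℝ) < B₁ := by exact_mod_cast hBB₁
    exact Real.sqrt_pos.2 (mul_pos h1 (by linarith))
  have hn := noiseConst_nonneg (M := M) hC hc.le
  set s := √((minSize K T : ℝ) * ((B₁ : ℝ) - B)) with hs_def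
  set x := √(minSize K T : ℝ) * (1 / √(d : ℝ) * separation K μ - γ / s) with hx_def
  have hx0 : 0 < x := mul_pos hsT (sub_pos.2 hx)
  have hmem : ∀ k ∈ Finset.Icc 2 K, ∀ j ∈ ({k, 1} : Set ℕ), j ∈ Finset.Icc 1 K := by
    intro k hk j hj
    rw [Finset.mem_Icc] at hk ⊢
    rcases hj with rfl | rfl <;> omega
  set N : ℕ → Ω → ℝ := fun k ω => pairNoise T B B₁ μ (fun k t => errorSeries (e k) (g k) t ω) k
    with hN
  have hNm : ∀ k ∈ Finset.Icc 2 K, Measurable (N k) := fun k hk => by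
    have m1 := (h k (hmem k hk k (by simp))).measurable_errorSeries
    have m2 := (h 1 (hmem k hk 1 (by simp))).measurable_errorSeries
    simp only [hN, pairNoise, autoNoise, averageError]
    fun_prop
  have hNb : ∀ k ∈ Finset.Icc 2 K, eLpNorm (N k) (ENNReal.ofReal (M / 2)) P
      ≤ ENNReal.ofReal (noiseConst M C c) := fun k hk =>
    eLpNorm_pairNoise_le hM hc.le hB hBB₁ hL hε fun j hj => by
      have hj' := hmem k hk j hj
      have hTj := minSize_le (T := T) hj'
      refine ⟨h j hj', hB₁.trans hTj, hdT.trans ?_, norm_le_of_forall_abs_le hc.le (hμ j hj')⟩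
      gcongr
  have hsum : eLpNorm (∑ k ∈ Finset.Icc 2 K, N k) (ENNReal.ofReal (M / 2)) P
      ≤ ENNReal.ofReal (K * noiseConst M C c) := by
    refine (eLpNorm_sum_le (fun k hk => (hNm k hk).aestronglyMeasurable)
      (by simp; linarith)).trans ((Finset.sum_le_sum hNb).trans ?_)
    rw [Finset.sum_const, nsmul_eq_mul, ENNReal.ofReal_mul (Nat.cast_nonneg _),
      ENNReal.ofReal_natCast]
    gcongr
    rw [Nat.card_Icc]; omega
  have hsub : {ω | scaledStatistic K T B B₁ (observation μ e g ω) ≤ γ}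
      ⊆ {ω | x / √c ≤ |(∑ k ∈ Finset.Icc 2 K, N k) ω|} := by
    intro ω hω
    have hω' : s * testStatistic K T B B₁
        (fun k t => μ k + errorSeries (e k) (g k) t ω) ≤ γ := hω
    rw [testStatistic_eq hT0, mul_comm, ← le_div_iff₀ hs] at hω'
    -- On the event, `(Δ + N)/√d ≤ γ/s`; isolating `-N` and multiplying by `√T∘` leaves `x` on the
    -- left.
    have h1 : x ≤ √(minSize K T : ℝ) / √(d : ℝ) * -(∑ k ∈ Finset.Icc 2 K, N k ω) := by
      have := mul_le_mul_of_nonneg_left hω' hsT.le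
      rw [hx_def, mul_sub]
      have e1 : √(minSize K T : ℝ) / √(d : ℝ) * -(∑ k ∈ Finset.Icc 2 K, N k ω)
          = √(minSize K T : ℝ) * (1 / √(d : ℝ) * separation K μ)
            - √(minSize K T : ℝ) * (1 / √(d : ℝ) * (separation K μ
              + ∑ k ∈ Finset.Icc 2 K, N k ω)) := by ring
      rw [e1]
      exact sub_le_sub_left this _
    have h2 : √(minSize K T : ℝ) / √(d : ℝ) ≤ √c := by
      rw [div_le_iff₀ hsd, ← Real.sqrt_mul hc.le]
      exact Real.sqrt_le_sqrt hTd
    simp only [Set.mem_ofPred_eq, Finset.sum_apply]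
    rw [div_le_iff₀ (Real.sqrt_pos.2 hc), mul_comm]
    calc x ≤ √(minSize K T : ℝ) / √(d : ℝ) * |∑ k ∈ Finset.Icc 2 K, N k ω| :=
          h1.trans (by gcongr; exact neg_le_abs _)
      _ ≤ _ := by gcongr
  calc _ ≤ P.real {ω | x / √c ≤ |(∑ k ∈ Finset.Icc 2 K, N k) ω|} := measureReal_mono hsub
    _ ≤ (K * noiseConst M C c / (x / √c)) ^ (M / 2) :=
        measureReal_le_of_eLpNorm_le (by linarith) (by positivity)
          (div_pos hx0 (Real.sqrt_pos.2 hc))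
          (Finset.aestronglyMeasurable_sum _ fun k hk => (hNm k hk).aestronglyMeasurable) hsum
    _ = _ := by
        rw [← Real.div_rpow (by positivity) hx0.le, div_div_eq_mul_div]

end TailBound

/-! ### Comparison of the growth rates -/

section Asymptotics

/-- The comparisons of the sizes that hold in all late experiments. -/
lemma eventually_size_bounds {d B B₁ τ : ℕ → ℕ} {α κ₁ κ₂ : ℝ} (C : ℝ)
    (hBB₁ : ∀ n, B n < B₁ n) (hτ : Tendsto τ atTop atTop)
    (hdT : (fun n => (d n : ℝ)) =Θ[atTop] fun n => (τ n : ℝ))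
    (hα : 0 < α) (hκ₁ : 1 / α < κ₁) (hκ : κ₁ < κ₂) (hκ₂ : κ₂ < 1)
    (hB : (fun n => (B n : ℝ)) =Θ[atTop] fun n => (τ n : ℝ) ^ κ₁)
    (hB₁ : (fun n => (B₁ n : ℝ)) =Θ[atTop] fun n => (τ n : ℝ) ^ κ₂) :
    ∃ c₀ : ℝ, ∀ c, c₀ ≤ c → ∀ᶠ n in atTop, (d n : ℝ) ≤ c * τ n ∧ (τ n : ℝ) ≤ c * d n ∧
      (B₁ n : ℝ) ≤ 2 * (B₁ n + 1 - B n : ℕ) ∧ d n * (C * (1 + B n : ℝ) ^ (-α)) ≤ c ∧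
      2 * B₁ n ≤ τ n := by
  have hτR : Tendsto (fun n => (τ n : ℝ)) atTop atTop := tendsto_natCast_atTop_atTop.comp hτ
  obtain ⟨c₁, hc₁, h₁⟩ := hdT.1.exists_pos
  obtain ⟨c₂, hc₂, h₂⟩ := hdT.2.exists_pos
  obtain ⟨c₃, hc₃, h₃⟩ := hB.1.exists_pos
  obtain ⟨c₄, hc₄, h₄⟩ := hB.2.exists_pos
  obtain ⟨c₅, hc₅, h₅⟩ := hB₁.1.exists_pos
  obtain ⟨c₆, hc₆, h₆⟩ := hB₁.2.exists_pos
  have hκ0 : 0 < κ₁ := (by positivity : 0 < 1 / α).trans hκ₁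
  have hgap : ∀ᶠ n in atTop, 2 * c₃ * c₆ ≤ (τ n : ℝ) ^ (κ₂ - κ₁) :=
    ((tendsto_rpow_atTop (by linarith)).comp hτR).eventually_ge_atTop _
  have hsmall : ∀ᶠ n in atTop, 2 * c₅ ≤ (τ n : ℝ) ^ (1 - κ₂) :=
    ((tendsto_rpow_atTop (by linarith)).comp hτR).eventually_ge_atTop _
  -- The entries serve `d ≤ cτ`, `τ ≤ cd` and the decoupling error; the other two bounds do not
  -- involve `c`. Allowing every larger `c` lets the caller use the same constant for the means.
  refine ⟨max (max c₁ c₂) (c₁ * (|C| * c₄ ^ α)), fun c hc => ?_⟩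
  have hcc₁ : c₁ ≤ c := ((le_max_left _ _).trans (le_max_left _ _)).trans hc
  have hcc₂ : c₂ ≤ c := ((le_max_right _ _).trans (le_max_left _ _)).trans hc
  have hcc₃ : c₁ * (|C| * c₄ ^ α) ≤ c := (le_max_right _ _).trans hc
  filter_upwards [h₁.bound, h₂.bound, h₃.bound, h₄.bound, h₅.bound, h₆.bound, hgap, hsmall,
    hτR.eventually_ge_atTop 1] with n g₁ g₂ g₃ g₄ g₅ g₆ g₇ g₈ hτ1
  have hτ0 : (0 : ℝ) < τ n := by linarith
  have hnorm : ∀ m : ℕ, ‖(m : ℝ)‖ = m := fun m => by simp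
  have hnormr : ∀ κ : ℝ, ‖(τ n : ℝ) ^ κ‖ = (τ n : ℝ) ^ κ := fun κ =>
    Real.norm_of_nonneg (by positivity)
  simp only [hnorm, hnormr] at g₁ g₂ g₃ g₄ g₅ g₆
  refine ⟨g₁.trans (by gcongr), g₂.trans (by gcongr), ?_, ?_, ?_⟩
  · have e1 : (τ n : ℝ) ^ κ₂ = (τ n : ℝ) ^ (κ₂ - κ₁) * (τ n : ℝ) ^ κ₁ := by
      rw [← Real.rpow_add hτ0, sub_add_cancel]
    -- Since `κ₁ < κ₂`, `B` is eventually at most half of `B₁`, so `B₁` is comparable with the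
    -- number of lags.
    have h2B : 2 * (B n : ℝ) ≤ B₁ n := by
      have h7 : c₆ * (2 * (B n : ℝ)) ≤ c₆ * B₁ n := by
        calc c₆ * (2 * (B n : ℝ)) ≤ c₆ * (2 * (c₃ * (τ n : ℝ) ^ κ₁)) := by gcongr
          _ = 2 * c₃ * c₆ * (τ n : ℝ) ^ κ₁ := by ring
          _ ≤ (τ n : ℝ) ^ (κ₂ - κ₁) * (τ n : ℝ) ^ κ₁ := by gcongr
          _ = (τ n : ℝ) ^ κ₂ := e1.symm
          _ ≤ _ := g₆
      exact le_of_mul_le_mul_left h7 hc₆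
    have := hBB₁ n
    rw [Nat.cast_sub (by omega)]
    push_cast
    linarith
  · have hBpos : 0 < (τ n : ℝ) ^ κ₁ / c₄ := by positivity
    have hle : (τ n : ℝ) ^ κ₁ / c₄ ≤ 1 + B n := by
      rw [div_le_iff₀ hc₄, mul_comm]
      exact g₄.trans (by gcongr; linarith)
    have hpow : (1 + B n : ℝ) ^ (-α) ≤ c₄ ^ α * (τ n : ℝ)⁻¹ := by
      calc (1 + B n : ℝ) ^ (-α) ≤ ((τ n : ℝ) ^ κ₁ / c₄) ^ (-α) :=
            Real.rpow_le_rpow_of_nonpos hBpos hle (by linarith)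
        _ = c₄ ^ α * (τ n : ℝ) ^ (-(κ₁ * α)) := by
            rw [Real.div_rpow (by positivity) hc₄.le, ← Real.rpow_mul hτ0.le, mul_neg,
              Real.rpow_neg hc₄.le, div_inv_eq_mul, mul_comm]
        _ ≤ c₄ ^ α * (τ n : ℝ) ^ (-1 : ℝ) := by
            have : 1 < κ₁ * α := by rwa [div_lt_iff₀ hα] at hκ₁
            gcongr
        _ = _ := by rw [Real.rpow_neg_one]
    calc d n * (C * (1 + B n : ℝ) ^ (-α))
        ≤ d n * (|C| * (1 + B n : ℝ) ^ (-α)) := by gcongr; exact le_abs_self C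
      _ ≤ c₁ * τ n * (|C| * (c₄ ^ α * (τ n : ℝ)⁻¹)) := by gcongr
      _ = c₁ * (|C| * c₄ ^ α) := by field_simp
      _ ≤ c := hcc₃
  · have h8 : 2 * (B₁ n : ℝ) ≤ τ n := by
      calc 2 * (B₁ n : ℝ) ≤ 2 * (c₅ * (τ n : ℝ) ^ κ₂) := by gcongr
        _ = 2 * c₅ * (τ n : ℝ) ^ κ₂ := by ring
        _ ≤ (τ n : ℝ) ^ (1 - κ₂) * (τ n : ℝ) ^ κ₂ := by gcongr
        _ = τ n := by rw [← Real.rpow_add hτ0, sub_add_cancel, Real.rpow_one]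
    exact_mod_cast h8

/-- The argument of the tail bound dominates the separation of the means. -/
lemma separation_sub_le {d B B₁ τ : ℕ} {c γ Δ : ℝ} (hc : 0 < c) (hd : 1 ≤ d) (hτ : 0 < τ)
    (hBB₁ : B < B₁) (hdT : (d : ℝ) ≤ c * τ) (hγ : 0 < γ) (hΔ : 0 ≤ Δ) :
    Δ / √c - γ ≤ √(τ : ℝ) * (1 / √(d : ℝ) * Δ - γ / √((τ : ℝ) * ((B₁ : ℝ) - B))) := by
  have hsτ : 0 < √(τ : ℝ) := Real.sqrt_pos.2 (by exact_mod_cast hτ)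
  have hsd : 0 < √(d : ℝ) := Real.sqrt_pos.2 (by exact_mod_cast hd)
  have hsc : 0 < √c := Real.sqrt_pos.2 hc
  have h1 : √(d : ℝ) ≤ √c * √(τ : ℝ) := by
    rw [← Real.sqrt_mul hc.le]; exact Real.sqrt_le_sqrt hdT
  -- The bandwidths are integers, so `B₁ - B ≥ 1`.
  have h2 : √(τ : ℝ) ≤ √((τ : ℝ) * ((B₁ : ℝ) - B)) := by
    have : (B : ℝ) + 1 ≤ B₁ := by exact_mod_cast hBB₁
    exact Real.sqrt_le_sqrt (le_mul_of_one_le_right (Nat.cast_nonneg τ) (by linarith))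
  have h3 : Δ / √c ≤ √(τ : ℝ) * (1 / √(d : ℝ) * Δ) := by
    rw [div_le_iff₀ hsc]
    calc Δ = 1 / √(d : ℝ) * Δ * √(d : ℝ) := by field_simp
      _ ≤ 1 / √(d : ℝ) * Δ * (√c * √(τ : ℝ)) := by gcongr
      _ = _ := by ring
  have h4 : √(τ : ℝ) * (γ / √((τ : ℝ) * ((B₁ : ℝ) - B))) ≤ γ := by
    rw [mul_div_assoc', div_le_iff₀ (hsτ.trans_le h2), mul_comm]
    gcongr
  rw [mul_sub]; linarith

end Asymptotics

end TimeSeriesAnova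

/-! ### The corollary -/

open TimeSeriesAnova in
theorem corollaryB1
    -- the `n`-th experiment: its probability space, innovation space, sizes, bandwidths and model
    {Ω E : ℕ → Type*} [∀ n, MeasurableSpace (Ω n)] [∀ n, MeasurableSpace (E n)]
    (P : ∀ n, Measure (Ω n)) [∀ n, IsProbabilityMeasure (P n)]
    (K d B B₁ : ℕ → ℕ) (T : ℕ → ℕ → ℕ)
    (μ : ∀ n, ℕ → EuclideanSpace ℝ (Fin (d n)))
    (e : ∀ n, ℕ → ℤ → Ω n → E n)
    (g : ∀ n, ℕ → ℤ → (ℕ → E n) → EuclideanSpace ℝ (Fin (d n)))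
    (M α κ₁ κ₂ : ℝ)
    -- the setting
    (hK : ∀ n, 2 ≤ K n) (hd : ∀ n, 1 ≤ d n)
    (hB : ∀ n, 0 < B n) (hBB₁ : ∀ n, B n < B₁ n) (hB₁ : ∀ n, B₁ n < minSize (K n) (T n))
    (hT : Tendsto (fun n => minSize (K n) (T n)) atTop atTop)
    -- the errors: independent innovations, short-range dependence uniformly in the experiment
    (hM : 8 < M) (hα : 14 < α)
    (hindep : ∀ n, iIndepFun (fun p : ℤ × Finset.Icc 1 (K n) => e n p.2 p.1) (P n))
    (hsrd : ∃ C : ℝ≥0, ∀ n, ∀ k ∈ Finset.Icc 1 (K n),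
      IsShortRangeDependent (P n) (e n k) (g n k) M α C)
    -- number of populations, sample sizes, dimension, means
    (hKbdd : ∃ K₀ : ℕ, ∀ n, K n ≤ K₀)
    (hTT : (fun n => (minSize (K n) (T n) : ℝ)) =Θ[atTop] fun n => (maxSize (K n) (T n) : ℝ))
    (hdT : (fun n => (d n : ℝ)) =Θ[atTop] fun n => (minSize (K n) (T n) : ℝ))
    (hμ : ∃ C : ℝ, ∀ n, ∀ k ∈ Finset.Icc 1 (K n), ∀ i, |μ n k i| ≤ C)
    -- bandwidths
    (hκ₁ : 2 / α < κ₁) (hκ₁' : κ₁ < 1 / 6)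
    (hκ₂ : max κ₁ (4 / (2 * α - 3)) < κ₂) (hκ₂' : κ₂ < 1 / 6)
    (hBT : (fun n => (B n : ℝ)) =Θ[atTop] fun n => (minSize (K n) (T n) : ℝ) ^ κ₁)
    (hB₁T : (fun n => (B₁ n : ℝ)) =Θ[atTop] fun n => (minSize (K n) (T n) : ℝ) ^ κ₂)
    -- nondegenerate variance
    (hvar : ∃ c : ℝ, 0 < c ∧ ∀ᶠ n in atTop,
      c < totalVariance (P n) (K n) (T n) (B n) (B₁ n) (e n) (g n))
    -- diverging separation of the means
    (hsep : Tendsto (fun n => separation (K n) (μ n)) atTop atTop) :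
    (∃ C : ℝ, ∀ γ : ℝ, 0 < γ → ∀ᶠ n in atTop,
      γ / √((minSize (K n) (T n) : ℝ) * ((B₁ n : ℝ) - B n))
          < 1 / √(d n : ℝ) * separation (K n) (μ n) ∧
      (P n).real {ω | scaledStatistic (K n) (T n) (B n) (B₁ n)
          (observation (μ n) (e n) (g n) ω) ≤ γ}
        ≤ C / (√(minSize (K n) (T n) : ℝ) *
            (1 / √(d n : ℝ) * separation (K n) (μ n)
              - γ / √((minSize (K n) (T n) : ℝ) * ((B₁ n : ℝ) - B n)))) ^ (M / 2)) ∧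
    (∀ γ : ℝ, 0 < γ →
      Tendsto (fun n => (P n).real {ω | scaledStatistic (K n) (T n) (B n) (B₁ n)
        (observation (μ n) (e n) (g n) ω) ≤ γ}) atTop (𝓝 0)) ∧
    (∀ γ : ℝ, 0 < γ →
      Tendsto (fun n => (P n).real {ω | γ < scaledStatistic (K n) (T n) (B n) (B₁ n)
        (observation (μ n) (e n) (g n) ω)}) atTop (𝓝 1)) := by 
  obtain ⟨C, hC⟩ := hsrd
  obtain ⟨K₀, hK₀⟩ := hKbdd
  obtain ⟨Cμ, hCμ⟩ := hμ
  have hα1 : 1 / α < κ₁ := lt_trans (by gcongr; norm_num) hκ₁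
  obtain ⟨c₀, hc₀⟩ := eventually_size_bounds (C : ℝ) hBB₁ hT hdT (by linarith) hα1
    ((le_max_left _ _).trans_lt hκ₂) (by linarith) hBT hB₁T
  -- One constant bounds the size ratios, the decoupling error and the coordinates of the means; the
  -- `1` makes it positive.
  set c := max (max c₀ Cμ) 1 with hc_def
  have hc : 0 < c := lt_of_lt_of_le one_pos (le_max_right _ _)
  have hsize := hc₀ c ((le_max_left _ _).trans (le_max_left _ _))
  have hn := noiseConst_nonneg (M := M) C.2 hc.le
  have hC' : 0 ≤ (K₀ * noiseConst M C c * √c) ^ (M / 2) := by positivity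
  have hΔ : ∀ n, 0 ≤ separation (K n) (μ n) := fun n =>
    Finset.sum_nonneg fun k _ => sq_nonneg _
  have hlower : ∀ γ : ℝ, 0 < γ → ∀ᶠ n in atTop, separation (K n) (μ n) / √c - γ
      ≤ √(minSize (K n) (T n) : ℝ) * (1 / √(d n : ℝ) * separation (K n) (μ n)
        - γ / √((minSize (K n) (T n) : ℝ) * ((B₁ n : ℝ) - B n))) := fun γ hγ => by
    filter_upwards [hsize] with n hn
    exact separation_sub_le hc (hd n) ((Nat.zero_le _).trans_lt (hB₁ n)) (hBB₁ n) hn.1 hγ (hΔ n)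
  have hdiv : ∀ γ : ℝ, Tendsto (fun n => separation (K n) (μ n) / √c - γ) atTop atTop := fun γ =>
    tendsto_atTop_add_const_right _ _ (hsep.atTop_div_const (Real.sqrt_pos.2 hc))
  have hbound : ∀ γ : ℝ, 0 < γ → ∀ᶠ n in atTop,
      γ / √((minSize (K n) (T n) : ℝ) * ((B₁ n : ℝ) - B n))
          < 1 / √(d n : ℝ) * separation (K n) (μ n) ∧
      (P n).real {ω | scaledStatistic (K n) (T n) (B n) (B₁ n)
          (observation (μ n) (e n) (g n) ω) ≤ γ}
        ≤ (K₀ * noiseConst M C c * √c) ^ (M / 2) / (√(minSize (K n) (T n) : ℝ) *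
            (1 / √(d n : ℝ) * separation (K n) (μ n)
              - γ / √((minSize (K n) (T n) : ℝ) * ((B₁ n : ℝ) - B n)))) ^ (M / 2) := by
    intro γ hγ
    filter_upwards [hsize, hlower γ hγ, (hdiv γ).eventually_gt_atTop 0] with n hs hl hp
    -- The lower bound `Δ/√c - γ` is positive for late `n`, which makes the argument of the tail
    -- bound positive.
    have hx : γ / √((minSize (K n) (T n) : ℝ) * ((B₁ n : ℝ) - B n))
        < 1 / √(d n : ℝ) * separation (K n) (μ n) :=
      sub_pos.1 (pos_of_mul_pos_right (hp.trans_le hl) (Real.sqrt_nonneg _))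
    obtain ⟨hs₁, hs₂, hs₃, hs₄, hs₅⟩ := hs
    refine ⟨hx, (measureReal_scaledStatistic_le (by linarith) hc (hd n) (hB n) (hBB₁ n) hs₅ hs₁
      hs₂ hs₃ hs₄ (fun k hk i => (hCμ n k hk i).trans ((le_max_right _ _).trans
        (le_max_left _ _))) (hC n) hx).trans ?_⟩
    -- Replacing `K n` by `K₀` makes the constant independent of both `n` and `γ`.
    have hKn : (K n : ℝ) ≤ K₀ := by exact_mod_cast hK₀ n
    have hpos := (hp.trans_le hl).le
    gcongr
  have hzero : ∀ γ : ℝ, 0 < γ →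
      Tendsto (fun n => (P n).real {ω | scaledStatistic (K n) (T n) (B n) (B₁ n)
        (observation (μ n) (e n) (g n) ω) ≤ γ}) atTop (𝓝 0) := by
    intro γ hγ
    have hlim : Tendsto (fun n => (K₀ * noiseConst M C c * √c) ^ (M / 2)
        / (√(minSize (K n) (T n) : ℝ) * (1 / √(d n : ℝ) * separation (K n) (μ n)
          - γ / √((minSize (K n) (T n) : ℝ) * ((B₁ n : ℝ) - B n)))) ^ (M / 2)) atTop (𝓝 0) :=
      ((tendsto_rpow_atTop (by linarith)).comp
        (tendsto_atTop_mono' _ (hlower γ hγ) (hdiv γ))).const_div_atTop _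
    exact squeeze_zero' (Eventually.of_forall fun n => measureReal_nonneg)
      ((hbound γ hγ).mono fun n hn => hn.2) hlim
  refine ⟨⟨_, hbound⟩, hzero, fun γ hγ => ?_⟩
  have hlim : Tendsto (fun n => 1 - (P n).real {ω | scaledStatistic (K n) (T n) (B n) (B₁ n)
      (observation (μ n) (e n) (g n) ω) ≤ γ}) atTop (𝓝 1) := by
    simpa using (hzero γ hγ).const_sub 1
  refine tendsto_of_tendsto_of_tendsto_of_le_of_le hlim tendsto_const_nhds (fun n => ?_)
    fun n => measureReal_le_one
  -- Subadditivity over the two events gives the lower bound on the power without any measurability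
  -- of the statistic.
  have hcover : (Set.univ : Set (Ω n)) ⊆ {ω | scaledStatistic (K n) (T n) (B n) (B₁ n)
      (observation (μ n) (e n) (g n) ω) ≤ γ} ∪ {ω | γ < scaledStatistic (K n) (T n) (B n) (B₁ n)
      (observation (μ n) (e n) (g n) ω)} := fun ω _ =>
    Set.mem_union _ _ _ |>.2 (le_or_gt (scaledStatistic _ _ _ _ (observation (μ n) (e n) (g n) ω)) γ)
  have h1 := (measureReal_mono (μ := P n) hcover).trans (measureReal_union_le _ _)
  rw [probReal_univ] at h1
  exact sub_le_iff_le_add'.2 h1
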